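/- Let $k\ge 0$ and $n$ be integers with $k\le (n-4)/3$, and let $G=(G_1,\dots,G_n)$ be a collection of $n$ (not necessarily distinct) simple graphs on a common vertex set $V$ with $|V|=n$, such that $\sigma_2(G_i)\ge n+k$ for every $i\in[n]$, where $\sigma_2(F)$ denotes the minimum of $d_F(x)+d_F(y)$ over all pairs of distinct non-adjacent vertices $x,y$ of $F$ (and $\sigma_2(F)=\infty$ if $F$ is complete). A set $E$ of edges on $V$ is *rainbow* with colouring $c$ if $c:E\to[n]$ is injective and $e\in E(G_{c(e)})$ for all $e\in E$. A *linear forest* is a forest all of whose components are paths (possibly single vertices). Let $H$ be a rainbow linear forest in $G$ with exactly $k$ edges, with a fixed rainbow colouring $c$, and let $c(H)\subseteq[n]$ be its set of $k$ colours. Let $u,v\in V$ be an $H$-compatible pair, i.e. $d_H(u)\le 1$, $d_H(v)\le 1$, and $u,v$ lie in different components $H_u\ne H_v$ of $H$. Here $H_u$ and $H_v$ are allowed to be single vertices and are always counted as components of $H$, while every other component of $H$ is required to contain an edge; thus $V(H)$ consists of $u$, $v$ and all endpoints of edges of $H$. Then at least one of the following holds. (C1) There is a rainbow Hamiltonian $u,v$-path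 containing $H$, with a rainbow colouring that extends the colouring $c$ of $H$. (C2) $H$ has exactly the two components $H_u$ and $H_v$, and there is a partition $V\setminus V(H)=X\cup Y$ with $|X|,|Y|\ge 1$ such that for every unused colour $i\in[n]\setminus c(H)$: $X$ and $Y$ are cliques in $G_i$, $G_i$ has no edge between $X$ and $Y$, and every vertex of $V(H)$ is adjacent in $G_i$ to every vertex of $X\cup Y$. (C3) There is a partition $V=X\cup Y$ with $|X|=(n+k)/2$ and $|Y|=(n-k)/2$ (so $n+k$ is even) such that $V(H)\subseteq X$ and, for every $i\in[n]\setminus c(H)$, every vertex of $X$ is adjacent in $G_i$ to every vertex of $Y$, and $Y$ is an independent set in $G_i$. -/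

import Mathlib

namespace RainbowOre

variable {V : Type*}

/-- `σ₂(G)`: the minimum of `d(x) + d(y)` over pairs of distinct non-adjacent vertices. It takes the
value `⊤` on a complete graph, where there is no such pair. -/
noncomputable def sigma2 [Fintype V] (G : SimpleGraph V) [DecidableRel G.Adj] : ℕ∞ :=
  ⨅ (x : V) (y : V) (_ : x ≠ y ∧ ¬ G.Adj x y), ((G.degree x + G.degree y : ℕ) : ℕ∞)

/-- A forest each of whose connected components is a path (possibly a single vertex). -/
def IsLinearForest (H : SimpleGraph V) : Prop :=
  H.IsAcyclic ∧ ∀ C : H.ConnectedComponent, ∃ (a b : V) (p : H.Walk a b),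
    p.IsPath ∧ p.toSubgraph = (⊤ : H.Subgraph).induce C.supp

/-- `c` is a rainbow colouring of the edge set `E` in the collection `G`: distinct edges of `E` get
distinct colours, and each `e ∈ E` is an edge of the graph `G (c e)`. (Values of `c` outside `E` are
irrelevant.) -/
def IsRainbowColoring {n : ℕ} (G : Fin n → SimpleGraph V) (E : Set (Sym2 V))
    (c : Sym2 V → Fin n) : Prop :=
  Set.InjOn c E ∧ ∀ e ∈ E, e ∈ (G (c e)).edgeSet

/-- The pair `u, v` is `H`-compatible: `u` and `v` have degree at most one in `H` and lie in
different components of `H`. -/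
def Compatible [Fintype V] (H : SimpleGraph V) [DecidableRel H.Adj] (u v : V) : Prop :=
  H.degree u ≤ 1 ∧ H.degree v ≤ 1 ∧ H.connectedComponentMk u ≠ H.connectedComponentMk v

/-- The vertex set `V(H)` of the linear forest with edge set `E(H)`, relative to the pair `u, v`:
the components of `u` and `v` belong to the forest even when they are single vertices, and every
other component contains at least one edge. -/
def forestVerts (H : SimpleGraph V) (u v : V) : Set V :=
  H.support ∪ {u, v}

end RainbowOre

/-! Let `m` be the number of components of `H` (with those of `u` and `v`) and `U` the complement of
V(H). Then |V(H)| = k + m, |U| = n - k - m, and n - k = |U| + m colours are unused. Inside `U`, two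
vertices non-adjacent in `G i` keep degree sum at least n + k - 2(k + m) = |U| - m.

The first half covers `U` by rainbow paths in unused colours. Take a cover with the fewest paths,
say M ≥ m of them, and ends `x`, `y` of different paths. If an edge qq' of the cover had `x` joined
to `q` in one unused colour and `y` joined to q' in another, an exchange would save a path
(`eq_of_cross`). With J the set of unused colours, every edge of the cover therefore carries at most
|J| of the 2|J| possible adjacencies, while the Ore condition demands |J| on average. Equality holds
everywhere (`cross`): M = m, and at each edge the adjacencies are the same in all unused colours.
From this rigidity the cover is either alternating (all ends have one common neighbourhood T, and
every path alternates between T and its complement) or consists of two paths whose ends see exactly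
their own path (`alternating_or_split`). Exchanges that turn a given vertex into an end, or release
a given colour, spread the structure to all vertices and colours (`adj_iff_of_alternating_all`,
`adj_iff_of_split_all`). Degree sums inside `U` are then as small as permitted, so the missing
degree comes from complete adjacency to V(H); these are (C3) and (C2).

Otherwise fewer than `m` paths cover `U`. They fit into the m - 1 gaps between the components of
`H`, at most one in each, giving a Hamiltonian path from `u` to `v` through `H`. Its joining edges
all meet V(H), and distinct colours are chosen for them arbitrarily, so only they can be bad, that
is, absent from the graph of their colour. Let xy be bad of colour i and let j be a colour missing
on the path. If neither recolouring nor an exchange with i and j helps, count the adjacencies of `x`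
and `y` in both colours: an edge outside `H` carries at most two, an edge of `H` at most four, xy
none, and the ends of the path add at most four. The total 2(n - 2 - k) + 4k + 4 = 2(n + k) is
exactly what the Ore condition needs, and it is not reached when `x` or `y` lies in V(H)
(`exists_improve`). Exchanges create no new bad edges, so repetition gives (C1). -/

namespace RainbowOre

/-! ### Paths as lists: consecutive pairs, edges and ends. -/

section Lists

variable {α : Type*}

/-- The list of ordered pairs of consecutive entries of a list. -/
def slots : List α → List (α × α)
  | [] => []
  | [_] => []
  | a :: b :: l => (a, b) :: slots (b :: l)

@[simp] theorem slots_nil : slots ([] : List α) = [] := rfl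

@[simp] theorem slots_singleton (a : α) : slots [a] = [] := rfl

@[simp] theorem slots_cons_cons (a b : α) (l : List α) :
    slots (a :: b :: l) = (a, b) :: slots (b :: l) := rfl

theorem slots_append_cons_cons (A B : List α) (x y : α) :
    slots (A ++ x :: y :: B) = slots (A ++ [x]) ++ (x, y) :: slots (y :: B) := by
  induction A with
  | nil => simp
  | cons a A ih => cases A with
    | nil => simp
    | cons b A => simpa using ih

theorem slots_reverse (l : List α) : slots l.reverse = ((slots l).map Prod.swap).reverse := by
  induction l with
  | nil => rfl
  | cons a l ih => cases l with
    | nil => rfl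
    | cons b l =>
      have := slots_append_cons_cons l.reverse [] b a
      simp only [List.reverse_cons, List.append_assoc, List.cons_append, List.nil_append] at *
      rw [this, ih]
      simp

theorem mem_slots {q q' : α} {l : List α} :
    (q, q') ∈ slots l ↔ ∃ P Q, l = P ++ q :: q' :: Q := by
  constructor
  · induction l with
    | nil => simp
    | cons a l ih => cases l with
      | nil => simp
      | cons b l =>
        simp only [slots_cons_cons, List.mem_cons, Prod.mk.injEq]
        rintro (⟨rfl, rfl⟩ | h)
        · exact ⟨[], l, rfl⟩
        · obtain ⟨P, Q, h⟩ := ih h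
          exact ⟨a :: P, Q, by simp [h]⟩
  · rintro ⟨P, Q, rfl⟩
    simp [slots_append_cons_cons]

theorem mem_slots_reverse {q q' : α} {l : List α} :
    (q, q') ∈ slots l.reverse ↔ (q', q) ∈ slots l := by
  simp [slots_reverse]

theorem length_slots {l : List α} (hl : l ≠ []) : (slots l).length + 1 = l.length := by
  induction l with
  | nil => simp at hl
  | cons a l ih => cases l with
    | nil => rfl
    | cons b l => simpa using ih (by simp)

theorem mem_of_mem_slots {q q' : α} {l : List α} (h : (q, q') ∈ slots l) : q ∈ l ∧ q' ∈ l := by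
  obtain ⟨P, Q, rfl⟩ := mem_slots.1 h
  simp

theorem ne_of_mem_slots {q q' : α} {l : List α} (hl : l.Nodup) (h : (q, q') ∈ slots l) :
    q ≠ q' := by
  obtain ⟨P, Q, rfl⟩ := mem_slots.1 h
  simp only [List.nodup_append, List.nodup_cons, List.mem_cons, not_or] at hl
  exact hl.2.1.1.1

theorem exists_slot_left {z : α} {l : List α} (hz : z ∈ l) :
    (∃ P, l = P ++ [z]) ∨ ∃ q', (z, q') ∈ slots l := by
  obtain ⟨P, Q, rfl⟩ := List.append_of_mem hz
  cases Q with
  | nil => exact Or.inl ⟨P, rfl⟩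
  | cons b Q => exact Or.inr ⟨b, mem_slots.2 ⟨P, Q, rfl⟩⟩

theorem exists_slot_right {z : α} {l : List α} (hz : z ∈ l) :
    (∃ Q, l = z :: Q) ∨ ∃ q, (q, z) ∈ slots l := by
  rcases exists_slot_left (List.mem_reverse.2 hz) with ⟨P, h⟩ | ⟨q, h⟩
  · left
    exact ⟨P.reverse, by simpa using congrArg List.reverse h⟩
  · exact Or.inr ⟨q, mem_slots_reverse.1 h⟩

/-- The edges joining consecutive entries of a list. -/
def pathEdges (l : List α) : Multiset (Sym2 α) := ((slots l).map (fun s => s(s.1, s.2)) : List _)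

@[simp] theorem pathEdges_nil : pathEdges ([] : List α) = 0 := rfl

@[simp] theorem pathEdges_singleton (a : α) : pathEdges [a] = 0 := rfl

@[simp] theorem pathEdges_cons_cons (a b : α) (l : List α) :
    pathEdges (a :: b :: l) = s(a, b) ::ₘ pathEdges (b :: l) := rfl

theorem pathEdges_append_cons_cons (A B : List α) (x y : α) :
    pathEdges (A ++ x :: y :: B) = s(x, y) ::ₘ (pathEdges (A ++ [x]) + pathEdges (y :: B)) := by
  simp only [pathEdges, slots_append_cons_cons, List.map_append, List.map_cons,
    ← Multiset.coe_add, ← Multiset.cons_coe]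
  rw [Multiset.add_cons]

@[simp] theorem pathEdges_reverse (l : List α) : pathEdges l.reverse = pathEdges l := by
  simp only [pathEdges, slots_reverse, List.map_reverse, Multiset.coe_reverse, List.map_map]
  congr 1
  apply List.map_congr_left
  intro s _
  exact Sym2.eq_swap

theorem mem_pathEdges {e : Sym2 α} {l : List α} :
    e ∈ pathEdges l ↔ ∃ q q', (q, q') ∈ slots l ∧ e = s(q, q') := by
  simp [pathEdges, eq_comm]

theorem mem_of_mem_pathEdges {e : Sym2 α} {z : α} {l : List α} (h : e ∈ pathEdges l)
    (hz : z ∈ e) : z ∈ l := by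
  obtain ⟨q, q', hs, rfl⟩ := mem_pathEdges.1 h
  have := mem_of_mem_slots hs
  rcases Sym2.mem_iff.1 hz with rfl | rfl <;> tauto

theorem nodup_pathEdges {l : List α} (hl : l.Nodup) : (pathEdges l).Nodup := by
  induction l with
  | nil => simp
  | cons a l ih => cases l with
    | nil => simp
    | cons b l =>
      rw [pathEdges_cons_cons, Multiset.nodup_cons]
      refine ⟨fun h => ?_, ih hl.of_cons⟩
      exact (List.nodup_cons.1 hl).1 (mem_of_mem_pathEdges h (Sym2.mem_mk_left a b))

theorem card_pathEdges {l : List α} (hl : l ≠ []) : (pathEdges l).card + 1 = l.length := by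
  simpa [pathEdges] using length_slots hl

/-- The edges of a family of paths given as a list of lists. -/
def coverEdges (L : List (List α)) : Multiset (Sym2 α) := (L.map pathEdges).sum

@[simp] theorem coverEdges_nil : coverEdges ([] : List (List α)) = 0 := rfl

@[simp] theorem coverEdges_cons (l : List α) (L : List (List α)) :
    coverEdges (l :: L) = pathEdges l + coverEdges L := by simp [coverEdges]

@[simp] theorem coverEdges_append (L L' : List (List α)) :
    coverEdges (L ++ L') = coverEdges L + coverEdges L' := by simp [coverEdges]

theorem coverEdges_perm {L L' : List (List α)} (h : L.Perm L') : coverEdges L = coverEdges L' :=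
  (h.map _).sum_eq

theorem mem_coverEdges {e : Sym2 α} {L : List (List α)} :
    e ∈ coverEdges L ↔ ∃ l ∈ L, e ∈ pathEdges l := by
  induction L with
  | nil => simp
  | cons l L ih => simp [ih]

theorem nodup_coverEdges {L : List (List α)} (hL : L.flatten.Nodup) : (coverEdges L).Nodup := by
  induction L with
  | nil => simp
  | cons l L ih =>
    rw [List.flatten_cons, List.nodup_append] at hL
    rw [coverEdges_cons, Multiset.nodup_add]
    refine ⟨nodup_pathEdges hL.1, ih hL.2.1, ?_⟩
    rw [Multiset.disjoint_left]
    intro e he he'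
    obtain ⟨l', hl', he'⟩ := mem_coverEdges.1 he'
    induction e with
    | h a b =>
      exact hL.2.2 a (mem_of_mem_pathEdges he (Sym2.mem_mk_left a b)) a
        (List.mem_flatten.2 ⟨l', hl', mem_of_mem_pathEdges he' (Sym2.mem_mk_left a b)⟩) rfl

theorem card_coverEdges {L : List (List α)} (hL : [] ∉ L) :
    (coverEdges L).card + L.length = L.flatten.length := by
  induction L with
  | nil => simp
  | cons l L ih =>
    simp only [List.mem_cons, not_or] at hL
    have h1 := ih hL.2
    have h2 := card_pathEdges (Ne.symm hL.1)
    simp only [coverEdges_cons, Multiset.card_add, List.length_cons, List.flatten_cons,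
      List.length_append]
    omega

theorem card_flatMap_slots {L : List (List α)} (hL : [] ∉ L) :
    (L.flatMap slots).length + L.length = L.flatten.length := by
  induction L with
  | nil => simp
  | cons l L ih =>
    simp only [List.mem_cons, not_or] at hL
    have h1 := ih hL.2
    have h2 := length_slots (Ne.symm hL.1)
    simp only [List.flatMap_cons, List.length_cons, List.flatten_cons, List.length_append]
    omega

theorem exists_perm_cons {l : α} {L : List α} (hl : l ∈ L) : ∃ L', L.Perm (l :: L') := by
  obtain ⟨s, t, rfl⟩ := List.append_of_mem hl
  exact ⟨s ++ t, List.perm_middle⟩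

/-- `x` is the first or the last entry of the list `l`. -/
def IsEnd (x : α) (l : List α) : Prop := (∃ Q, l = x :: Q) ∨ ∃ P, l = P ++ [x]

theorem isEnd_cons (x : α) (l : List α) : IsEnd x (x :: l) := Or.inl ⟨l, rfl⟩

theorem isEnd_concat (x : α) (l : List α) : IsEnd x (l ++ [x]) := Or.inr ⟨l, rfl⟩

theorem IsEnd.mem {x : α} {l : List α} (h : IsEnd x l) : x ∈ l := by
  rcases h with ⟨Q, rfl⟩ | ⟨P, rfl⟩ <;> simp

theorem isEnd_reverse {x : α} {l : List α} : IsEnd x l.reverse ↔ IsEnd x l := by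
  constructor
  · rintro (⟨Q, h⟩ | ⟨P, h⟩)
    · exact Or.inr ⟨Q.reverse, by simpa using congrArg List.reverse h⟩
    · exact Or.inl ⟨P.reverse, by simpa using congrArg List.reverse h⟩
  · rintro (⟨Q, rfl⟩ | ⟨P, rfl⟩)
    · exact Or.inr ⟨Q.reverse, by simp⟩
    · exact Or.inl ⟨P.reverse, by simp⟩

end Lists

/-! ### Rainbow path covers and their exchanges. -/

section Covers

variable {U ι : Type*}

/-- `L` is a family of nonempty paths that partitions the vertex set, and `col` is a rainbow
colouring of its edges in the collection `F`. -/
structure IsRainbowCover (F : ι → SimpleGraph U) (L : List (List U)) (col : Sym2 U → ι) :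
    Prop where
  nodup : L.flatten.Nodup
  cover : ∀ x, x ∈ L.flatten
  ne_nil : [] ∉ L
  inj : Set.InjOn col {e | e ∈ coverEdges L}
  mem : ∀ e ∈ coverEdges L, e ∈ (F (col e)).edgeSet

/-- The colour `j` is not used by `col` on the edges of `L`. -/
def Unused (L : List (List U)) (col : Sym2 U → ι) (j : ι) : Prop := ∀ e ∈ coverEdges L, col e ≠ j

variable {F : ι → SimpleGraph U} {L L' : List (List U)} {col : Sym2 U → ι}

theorem IsRainbowCover.perm (h : IsRainbowCover F L col) (hL : L.Perm L') :
    IsRainbowCover F L' col where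
  nodup := hL.flatten.nodup_iff.1 h.nodup
  cover x := hL.flatten.mem_iff.1 (h.cover x)
  ne_nil h' := h.ne_nil (hL.mem_iff.2 h')
  inj := by rw [← coverEdges_perm hL]; exact h.inj
  mem := by rw [← coverEdges_perm hL]; exact h.mem

theorem Unused.perm {j : ι} (h : Unused L col j) (hL : L.Perm L') : Unused L' col j := by
  unfold Unused; rw [← coverEdges_perm hL]; exact h

theorem IsRainbowCover.reverse {l : List U} (h : IsRainbowCover F (l :: L) col) :
    IsRainbowCover F (l.reverse :: L) col where
  nodup := by
    have : (l.reverse :: L).flatten.Perm (l :: L).flatten := by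
      simpa using (List.reverse_perm l).append_right L.flatten
    exact this.nodup_iff.2 h.nodup
  cover x := by simpa using h.cover x
  ne_nil := by simpa using h.ne_nil
  inj := by simpa using h.inj
  mem := by simpa using h.mem

theorem Unused.reverse {l : List U} {j : ι} (h : Unused (l :: L) col j) :
    Unused (l.reverse :: L) col j := by simpa [Unused] using h

theorem Unused.swap_two {A B : List U} {j : ι} (h : Unused [A, B] col j) : Unused [B, A] col j :=
  h.perm (.swap _ _ _)

theorem IsRainbowCover.nodup_head {l : List U} (h : IsRainbowCover F (l :: L) col) : l.Nodup := by
  have := h.nodup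
  rw [List.flatten_cons, List.nodup_append] at this
  exact this.1

variable [DecidableEq U]

/-- Keep some of the edges of a rainbow cover and add one edge in a colour not used on those. -/
theorem IsRainbowCover.replace (h : IsRainbowCover F L col) {M : Multiset (Sym2 U)} {f : Sym2 U}
    {j : ι} (hM : M ≤ coverEdges L) (hL' : coverEdges L' = f ::ₘ M)
    (hflat : L.flatten.Perm L'.flatten) (hne : [] ∉ L') (hf : f ∈ (F j).edgeSet)
    (hj : ∀ e ∈ M, col e ≠ j) : IsRainbowCover F L' (Function.update col f j) := by
  have hnd : L'.flatten.Nodup := hflat.nodup_iff.1 h.nodup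
  have hfM : f ∉ M := by
    have := nodup_coverEdges hnd
    rw [hL', Multiset.nodup_cons] at this
    exact this.1
  have hcol : ∀ e ∈ M, Function.update col f j e = col e := fun e he =>
    Function.update_of_ne (by rintro rfl; exact hfM he) _ _
  refine ⟨hnd, fun x => hflat.mem_iff.1 (h.cover x), hne, ?_, ?_⟩
  · rw [hL']
    intro a ha b hb hab
    simp only [Multiset.mem_cons, Set.mem_ofPred_eq] at ha hb
    rcases ha with rfl | ha <;> rcases hb with rfl | hb
    · rfl
    · rw [hcol b hb, Function.update_self] at hab
      exact absurd hab.symm (hj b hb)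
    · rw [hcol a ha, Function.update_self] at hab
      exact absurd hab (hj a ha)
    · rw [hcol a ha, hcol b hb] at hab
      exact h.inj (Multiset.mem_of_le hM ha) (Multiset.mem_of_le hM hb) hab
  · rw [hL']
    intro e he
    rcases Multiset.mem_cons.1 he with rfl | he
    · simpa using hf
    · rw [hcol e he]
      exact h.mem e (Multiset.mem_of_le hM he)

/-- The exchange consumes only `j` and releases the colour of `e`. The surviving unused colours
allow a second edge to be added afterwards, and the released one gives access to any colour that the
cover uses. -/
theorem IsRainbowCover.unused_replace (h : IsRainbowCover F L col) {M : Multiset (Sym2 U)}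
    {e f : Sym2 U} {j : ι} (hL : coverEdges L = e ::ₘ M) (hL' : coverEdges L' = f ::ₘ M)
    (hj : Unused L col j) (i : ι) (hi : i = col e ∨ Unused L col i ∧ i ≠ j) :
    Unused L' (Function.update col f j) i := by
  intro g hg
  have heM : e ∉ M := by
    have := nodup_coverEdges h.nodup
    rw [hL, Multiset.nodup_cons] at this
    exact this.1
  by_cases hgf : g = f
  · subst hgf
    rw [Function.update_self]
    rcases hi with rfl | ⟨_, hi⟩
    · exact (hj e (by simp [hL])).symm
    · exact hi.symm
  · rw [Function.update_of_ne hgf]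
    have hgM : g ∈ M := by
      rw [hL', Multiset.mem_cons] at hg
      exact hg.resolve_left hgf
    rcases hi with rfl | ⟨hi, _⟩
    · intro hh
      have := h.inj (x₁ := g) (x₂ := e) (by simp [hL, hgM]) (by simp [hL]) hh
      exact heM (this ▸ hgM)
    · exact hi g (by simp [hL, hgM])

/-- Joining two paths at their ends. -/
theorem IsRainbowCover.merge {A B : List U} {x y : U} {j : ι}
    (h : IsRainbowCover F ((A ++ [x]) :: (y :: B) :: L) col)
    (hj : Unused ((A ++ [x]) :: (y :: B) :: L) col j) (hxy : (F j).Adj x y) :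
    IsRainbowCover F ((A ++ x :: y :: B) :: L) (Function.update col s(x, y) j) := by
  refine h.replace le_rfl ?_ (by simp) ?_ hxy hj
  · simp [pathEdges_append_cons_cons, add_assoc]
  · have := h.ne_nil
    simp at this ⊢
    exact this

/-- Rotating a path: its last vertex `x` gets joined to `q`, the successor `q'` of `q` becomes the
last vertex. -/
theorem IsRainbowCover.rotate {P Q : List U} {q q' x : U} {j : ι}
    (h : IsRainbowCover F ((P ++ q :: q' :: Q) :: L) col) (hx : ∃ R, q' :: Q = R ++ [x])
    (hj : Unused ((P ++ q :: q' :: Q) :: L) col j) (hxq : (F j).Adj x q) :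
    ∃ col', IsRainbowCover F ((P ++ q :: (q' :: Q).reverse) :: L) col' ∧
      ∀ i, (i = col s(q, q') ∨ Unused ((P ++ q :: q' :: Q) :: L) col i ∧ i ≠ j) →
        Unused ((P ++ q :: (q' :: Q).reverse) :: L) col' i := by
  obtain ⟨R, hR⟩ := hx
  have h1 : coverEdges ((P ++ q :: q' :: Q) :: L) =
      s(q, q') ::ₘ (pathEdges (P ++ [q]) + pathEdges (q' :: Q) + coverEdges L) := by
    simp [pathEdges_append_cons_cons]
  have h2 : coverEdges ((P ++ q :: (q' :: Q).reverse) :: L) =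
      s(x, q) ::ₘ (pathEdges (P ++ [q]) + pathEdges (q' :: Q) + coverEdges L) := by
    have : (q' :: Q).reverse = x :: R.reverse := by rw [hR]; simp
    rw [← pathEdges_reverse (q' :: Q), this, coverEdges_cons, pathEdges_append_cons_cons,
      Multiset.cons_add, Sym2.eq_swap]
  refine ⟨_, h.replace (by rw [h1]; exact Multiset.le_cons_self _ _) h2 ?_ ?_ hxq ?_,
    h.unused_replace h1 h2 hj⟩
  · simp only [List.flatten_cons]
    refine (List.Perm.append_left _ ?_).append_right _
    exact (List.reverse_perm _).symm.cons q
  · have := h.ne_nil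
    simp at this ⊢
    exact this
  · intro e he
    exact hj e (by rw [h1]; exact Multiset.mem_cons_of_mem he)

/-- The last vertex `x` of a path gets joined to a vertex `q` of another path, which is split
after `q`. -/
theorem IsRainbowCover.attach {A P Q : List U} {q q' x : U} {j : ι}
    (h : IsRainbowCover F ((A ++ [x]) :: (P ++ q :: q' :: Q) :: L) col)
    (hj : Unused ((A ++ [x]) :: (P ++ q :: q' :: Q) :: L) col j) (hxq : (F j).Adj x q) :
    ∃ col', IsRainbowCover F ((A ++ x :: (P ++ [q]).reverse) :: (q' :: Q) :: L) col' ∧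
      ∀ i, (i = col s(q, q') ∨ Unused ((A ++ [x]) :: (P ++ q :: q' :: Q) :: L) col i ∧ i ≠ j) →
        Unused ((A ++ x :: (P ++ [q]).reverse) :: (q' :: Q) :: L) col' i := by
  have h1 : coverEdges ((A ++ [x]) :: (P ++ q :: q' :: Q) :: L) = s(q, q') ::ₘ
      (pathEdges (A ++ [x]) + (pathEdges (P ++ [q]) + (pathEdges (q' :: Q) + coverEdges L))) := by
    simp [pathEdges_append_cons_cons, add_assoc]
  have h2 : coverEdges ((A ++ x :: (P ++ [q]).reverse) :: (q' :: Q) :: L) = s(x, q) ::ₘ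
      (pathEdges (A ++ [x]) + (pathEdges (P ++ [q]) + (pathEdges (q' :: Q) + coverEdges L))) := by
    rw [← pathEdges_reverse (P ++ [q])]
    simp only [List.reverse_append, List.reverse_cons, List.reverse_nil, List.nil_append,
      List.cons_append, coverEdges_cons, pathEdges_append_cons_cons, Multiset.cons_add, add_assoc]
  refine ⟨_, h.replace (by rw [h1]; exact Multiset.le_cons_self _ _) h2 ?_ ?_ hxq ?_,
    h.unused_replace h1 h2 hj⟩
  · have : (P ++ [q]).Perm (P ++ [q]).reverse := (List.reverse_perm _).symm
    have := (((this.cons x).append_left A).append_right (q' :: Q)).append_right L.flatten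
    simpa using this
  · have := h.ne_nil
    simp at this ⊢
    exact this
  · intro e he
    exact hj e (by rw [h1]; exact Multiset.mem_cons_of_mem he)

end Covers

end RainbowOre

/-! ### Minimum covers and the crossing count. -/

namespace RainbowOre

/-- If both sets are nonempty, each is a singleton and the sum is at most two. Three elements in `J`
thus leave equality only to the case where one of the sets is empty. -/
theorem card_add_card_le_of_cross {ι : Type*} [DecidableEq ι] {A B J : Finset ι} (hA : A ⊆ J)
    (hB : B ⊆ J) (hAB : ∀ i ∈ A, ∀ j ∈ B, i = j) (hJ : 3 ≤ J.card) :
    A.card + B.card ≤ J.card ∧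
      (A.card + B.card = J.card → A = J ∧ B = ∅ ∨ A = ∅ ∧ B = J) := by
  rcases A.eq_empty_or_nonempty with rfl | ⟨a, ha⟩
  · refine ⟨by simpa using Finset.card_le_card hB, fun h => Or.inr ⟨rfl, ?_⟩⟩
    exact Finset.eq_of_subset_of_card_le hB (by simpa using h.ge)
  rcases B.eq_empty_or_nonempty with rfl | ⟨b, hb⟩
  · refine ⟨by simpa using Finset.card_le_card hA, fun h => Or.inl ⟨?_, rfl⟩⟩
    exact Finset.eq_of_subset_of_card_le hA (by simpa using h.ge)
  have h1 : A.card ≤ 1 := Finset.card_le_one.2 fun i hi i' hi' =>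
    (hAB i hi b hb).trans (hAB i' hi' b hb).symm
  have h2 : B.card ≤ 1 := Finset.card_le_one.2 fun i hi i' hi' =>
    (hAB a ha i hi).symm.trans (hAB a ha i' hi')
  omega

variable {U ι : Type*} [Fintype U] [Fintype ι]

/-- A rainbow path cover with the smallest number `m` of paths, in a collection of graphs with more
colours than vertices in which non-adjacent vertices have degree sum at least `|U| - m`. -/
structure IsMinCover (F : ι → SimpleGraph U) [∀ i, DecidableRel (F i).Adj] (m : ℕ)
    (L : List (List U)) (col : Sym2 U → ι) : Prop extends IsRainbowCover F L col where
  length_eq : L.length = m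
  min : ∀ L' col', IsRainbowCover F L' col' → m ≤ L'.length
  colors : Fintype.card U + 2 ≤ Fintype.card ι
  ore : ∀ i x y, x ≠ y → ¬ (F i).Adj x y →
    Fintype.card U ≤ (F i).degree x + (F i).degree y + m

variable {F : ι → SimpleGraph U} [∀ i, DecidableRel (F i).Adj] {m : ℕ}
  {L L' : List (List U)} {col col' : Sym2 U → ι}

namespace IsMinCover

/-- Minimality depends only on the number of paths, so an exchange preserving that number leads to a
cover to which the whole theory applies again. -/
theorem of_cover (h : IsMinCover F m L col) (h' : IsRainbowCover F L' col')
    (hlen : L'.length = L.length) : IsMinCover F m L' col' :=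
  ⟨h', hlen.trans h.length_eq, h.min, h.colors, h.ore⟩

theorem perm (h : IsMinCover F m L col) (hL : L.Perm L') : IsMinCover F m L' col :=
  h.of_cover (h.toIsRainbowCover.perm hL) hL.length_eq.symm

theorem reverse {l : List U} (h : IsMinCover F m (l :: L) col) :
    IsMinCover F m (l.reverse :: L) col :=
  h.of_cover h.toIsRainbowCover.reverse rfl

theorem exists_mem (h : IsMinCover F m L col) (z : U) : ∃ l ∈ L, z ∈ l := by
  simpa using h.cover z

theorem ne_nil_of_mem {l : List U} (h : IsMinCover F m L col) (hl : l ∈ L) : l ≠ [] := by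
  rintro rfl
  exact h.ne_nil hl

theorem swap_two {A B : List U} (h : IsMinCover F m [A, B] col) : IsMinCover F m [B, A] col :=
  h.perm (.swap _ _ _)

variable [DecidableEq U]

/-- Otherwise the two paths merge into one, against minimality. -/
theorem not_adj_last_head {A B : List U} {x y : U} {j : ι}
    (h : IsMinCover F m ((A ++ [x]) :: (y :: B) :: L) col)
    (hj : Unused ((A ++ [x]) :: (y :: B) :: L) col j) : ¬ (F j).Adj x y := by
  intro hxy
  have h1 := h.min _ _ (h.toIsRainbowCover.merge hj hxy)
  have h2 := h.length_eq
  simp at h1 h2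
  omega

/-- Ends of different paths are not adjacent in unused colours. -/
theorem not_adj_ends {l l' : List U} {x y : U} {j : ι}
    (h : IsMinCover F m (l :: l' :: L) col) (hj : Unused (l :: l' :: L) col j)
    (hx : IsEnd x l) (hy : IsEnd y l') : ¬ (F j).Adj x y := by
  wlog hx' : ∃ P, l = P ++ [x] generalizing l
  · refine this h.reverse hj.reverse (isEnd_reverse.2 hx) ?_
    obtain ⟨Q, rfl⟩ := hx.resolve_right hx'
    exact ⟨Q.reverse, by simp⟩
  obtain ⟨P, rfl⟩ := hx'
  wlog hy' : ∃ Q, l' = y :: Q generalizing l'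
  · refine this (l' := l'.reverse) (isEnd_reverse.2 hy) ?_ ?_ ?_
    · exact ((h.perm (.swap _ _ _)).reverse).perm (.swap _ _ _)
    · exact ((hj.perm (.swap _ _ _)).reverse).perm (.swap _ _ _)
    · obtain ⟨P, rfl⟩ := hy.resolve_left hy'
      exact ⟨P.reverse, by simp⟩
  obtain ⟨Q, rfl⟩ := hy'
  exact h.not_adj_last_head hj

/-- The two colours used in a crossing exchange must agree. -/
theorem eq_of_cross {A B : List U} {x y q q' : U} {j j' : ι}
    (h : IsMinCover F m ((A ++ [x]) :: (y :: B) :: L) col)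
    (hj : Unused ((A ++ [x]) :: (y :: B) :: L) col j)
    (hj' : Unused ((A ++ [x]) :: (y :: B) :: L) col j')
    (hq : (q, q') ∈ ((A ++ [x]) :: (y :: B) :: L).flatMap slots)
    (hxq : (F j).Adj x q) (hyq : (F j').Adj y q') : j = j' := by
  by_contra hne
  rw [List.mem_flatMap] at hq
  obtain ⟨l, hl, hq⟩ := hq
  obtain ⟨P, Q, hPQ⟩ := mem_slots.1 hq
  simp only [List.mem_cons] at hl
  rcases hl with rfl | rfl | hl
  -- Slot on the path of `x`: rotation makes `q'` an end of that path, and `j'` would join it to the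
  -- end `y` of another path.
  · rw [hPQ] at h hj hj'
    have hx : ∃ R, q' :: Q = R ++ [x] := by
      have hlast := congrArg List.getLast? hPQ
      rcases List.eq_nil_or_concat (q' :: Q) with h0 | ⟨R, b, h0⟩
      · simp at h0
      · rw [h0] at hPQ hlast
        have : P ++ q :: (R ++ [b]) = (P ++ q :: R) ++ [b] := by simp
        rw [List.concat_eq_append] at hlast h0
        rw [this, List.getLast?_concat, List.getLast?_concat, Option.some.injEq] at hlast
        exact ⟨R, by rw [h0, hlast]⟩
    obtain ⟨col', h', hu⟩ := h.toIsRainbowCover.rotate hx hj hxq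
    refine (h.of_cover h' rfl).not_adj_ends (hu j' (Or.inr ⟨hj', Ne.symm hne⟩))
      (x := q') (y := y) ?_ (isEnd_cons y B) hyq.symm
    exact Or.inr ⟨P ++ q :: Q.reverse, by simp⟩
  -- Slot on the path of `y`: the segment from `y` to `q` moves over to `x`, after which `y` and
  -- `q'` are ends of different paths.
  · rw [hPQ] at h hj hj'
    obtain ⟨col', h', hu⟩ := h.toIsRainbowCover.attach hj hxq
    refine (h.of_cover h' rfl).not_adj_ends (hu j' (Or.inr ⟨hj', Ne.symm hne⟩))
      (x := y) (y := q') ?_ (isEnd_cons q' Q) hyq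
    cases P with
    | nil =>
      simp only [List.nil_append, List.cons.injEq] at hPQ
      exact Or.inr ⟨A ++ [x], by simp [hPQ.1]⟩
    | cons b P =>
      simp only [List.cons_append, List.cons.injEq] at hPQ
      exact Or.inr ⟨A ++ x :: (P ++ [q]).reverse, by simp [hPQ.1]⟩
  -- Slot on a third path: its part up to `q` moves over to `x`, and the remainder, starting in
  -- `q'`, could be joined to `y`.
  · obtain ⟨L', hL'⟩ := exists_perm_cons hl
    have hp : ((A ++ [x]) :: (y :: B) :: L).Perm ((A ++ [x]) :: l :: (y :: B) :: L') :=
      ((hL'.cons _).trans (.swap _ _ _)).cons _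
    replace h := h.perm hp
    replace hj := hj.perm hp
    replace hj' := hj'.perm hp
    rw [hPQ] at h hj hj'
    obtain ⟨col', h', hu⟩ := h.toIsRainbowCover.attach hj hxq
    have hp' : ((A ++ x :: (P ++ [q]).reverse) :: (q' :: Q) :: (y :: B) :: L').Perm
        ((q' :: Q) :: (y :: B) :: (A ++ x :: (P ++ [q]).reverse) :: L') :=
      (List.Perm.swap _ _ _).trans ((List.Perm.swap _ _ _).cons _)
    exact ((h.of_cover h' rfl).perm hp').not_adj_ends
      ((hu j' (Or.inr ⟨hj', Ne.symm hne⟩)).perm hp') (isEnd_cons q' Q) (isEnd_cons y B) hyq.symm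

/-- A cover by `m` paths has |U| - m edges and consumes at most as many colours, out of at least |U|
+ 2. As m ≥ 2 in the crossing count, the three colours needed there are available. -/
theorem card_unused [DecidableEq ι] (h : IsMinCover F m L col) {J : Finset ι}
    (hJ : ∀ j, j ∈ J ↔ Unused L col j) : m + 2 ≤ J.card := by
  have h1 : Finset.univ ⊆ J ∪ (coverEdges L).toFinset.image col := by
    intro j _
    by_cases hj : Unused L col j
    · exact Finset.mem_union_left _ ((hJ j).2 hj)
    · simp only [Unused, not_forall, not_not] at hj
      obtain ⟨e, he, rfl⟩ := hj
      exact Finset.mem_union_right _ (Finset.mem_image_of_mem _ (by simpa using he))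
  have h2 := (Finset.card_le_card h1).trans (Finset.card_union_le _ _)
  have h3 : ((coverEdges L).toFinset.image col).card ≤ (coverEdges L).card :=
    Finset.card_image_le.trans (Multiset.toFinset_card_le _)
  have h4 := card_coverEdges h.ne_nil
  have h5 : L.flatten.length ≤ Fintype.card U := h.nodup.length_le_card
  have h6 := h.length_eq
  have h7 := h.colors
  rw [Finset.card_univ] at h2
  omega

/-- The degree counting along a minimum cover: the crossing bound is attained at every slot. -/
theorem cross {A B : List U} {x y : U} (h : IsMinCover F m ((A ++ [x]) :: (y :: B) :: L) col) :
    (∀ q q', (q, q') ∈ ((A ++ [x]) :: (y :: B) :: L).flatMap slots →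
      (∀ j, Unused ((A ++ [x]) :: (y :: B) :: L) col j → (F j).Adj x q ∧ ¬ (F j).Adj y q') ∨
      (∀ j, Unused ((A ++ [x]) :: (y :: B) :: L) col j → ¬ (F j).Adj x q ∧ (F j).Adj y q')) ∧
    ∃ j, Unused ((A ++ [x]) :: (y :: B) :: L) col j ∧
      (F j).degree x + (F j).degree y + m ≤ Fintype.card U := by
  classical
  set K := (A ++ [x]) :: (y :: B) :: L with hK
  set J : Finset ι := Finset.univ.filter (Unused K col) with hJdef
  have hJ : ∀ j, j ∈ J ↔ Unused K col j := by simp [hJdef]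
  have hJc := h.card_unused hJ
  have hm : 2 ≤ m := by rw [← h.length_eq]; simp [hK]
  set S : Finset (U × U) := (K.flatMap slots).toFinset with hS
  have hSc : S.card + m ≤ Fintype.card U := by
    have h1 : S.card ≤ (K.flatMap slots).length := List.toFinset_card_le _
    have h2 := card_flatMap_slots h.ne_nil
    have h3 : K.flatten.length ≤ Fintype.card U := h.nodup.length_le_card
    have h4 := h.length_eq
    omega
  have hmem : ∀ z, ∃ l ∈ K, z ∈ l := fun z => by simpa using h.cover z
  have hxy : x ≠ y := by
    have := h.nodup
    simp only [hK, List.flatten_cons, List.append_assoc, List.nodup_append] at this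
    intro hxy
    exact this.2.1.2.2 x (by simp) y (by simp) hxy
  -- A neighbour of `x` is never last on its path, since it would be `x` itself or an end of another
  -- path. Hence it is the first entry of a slot.
  have hx : ∀ j ∈ J, (F j).degree x ≤ (S.filter fun s => (F j).Adj x s.1).card := by
    intro j hj
    rw [← SimpleGraph.card_neighborFinset_eq_degree]
    refine (Finset.card_le_card (t := (S.filter fun s => (F j).Adj x s.1).image Prod.fst) ?_).trans
      Finset.card_image_le
    intro z hz
    rw [SimpleGraph.mem_neighborFinset] at hz
    obtain ⟨l, hl, hzl⟩ := hmem z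
    rcases exists_slot_left hzl with ⟨P, rfl⟩ | ⟨q', hq'⟩
    · exfalso
      simp only [hK, List.mem_cons] at hl
      rcases hl with hl | hl
      · have : z = x := by simpa using congrArg List.getLast? hl
        exact hz.ne this.symm
      · obtain ⟨L', hL'⟩ := exists_perm_cons (List.mem_cons.2 hl)
        exact (h.perm (hL'.cons _)).not_adj_ends (((hJ j).1 hj).perm (hL'.cons _))
          (isEnd_concat x A) (isEnd_concat z P) hz
    · refine Finset.mem_image.2 ⟨(z, q'), ?_, rfl⟩
      simp only [hS, Finset.mem_filter, List.mem_toFinset, List.mem_flatMap]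
      exact ⟨⟨l, hl, hq'⟩, hz⟩
  -- Symmetrically, a neighbour of `y` is never first on its path and so is the second entry of a
  -- slot.
  have hy : ∀ j ∈ J, (F j).degree y ≤ (S.filter fun s => (F j).Adj y s.2).card := by
    intro j hj
    rw [← SimpleGraph.card_neighborFinset_eq_degree]
    refine (Finset.card_le_card (t := (S.filter fun s => (F j).Adj y s.2).image Prod.snd) ?_).trans
      Finset.card_image_le
    intro z hz
    rw [SimpleGraph.mem_neighborFinset] at hz
    obtain ⟨l, hl, hzl⟩ := hmem z
    rcases exists_slot_right hzl with ⟨Q, rfl⟩ | ⟨q, hq⟩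
    · exfalso
      have hp : K.Perm ((y :: B) :: (A ++ [x]) :: L) := .swap _ _ _
      have hl' := hp.mem_iff.1 hl
      rw [List.mem_cons] at hl'
      rcases hl' with hl | hl
      · have : z = y := by simpa using congrArg List.head? hl
        exact hz.ne this.symm
      · obtain ⟨L', hL'⟩ := exists_perm_cons hl
        have hp' := hp.trans (hL'.cons _)
        exact (h.perm hp').not_adj_ends (((hJ j).1 hj).perm hp')
          (isEnd_cons y B) (isEnd_cons z Q) hz
    · refine Finset.mem_image.2 ⟨(q, z), ?_, rfl⟩
      simp only [hS, Finset.mem_filter, List.mem_toFinset, List.mem_flatMap]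
      exact ⟨⟨l, hl, hq⟩, hz⟩
  have hlow : ∀ j ∈ J, S.card ≤ (S.filter fun s => (F j).Adj x s.1).card +
      (S.filter fun s => (F j).Adj y s.2).card := by
    intro j hj
    have h1 := h.ore j x y hxy (h.not_adj_last_head ((hJ j).1 hj))
    have h2 := hx j hj
    have h3 := hy j hj
    omega
  have hup : ∀ s ∈ S, (J.filter fun j => (F j).Adj x s.1).card +
      (J.filter fun j => (F j).Adj y s.2).card ≤ J.card ∧
      ((J.filter fun j => (F j).Adj x s.1).card + (J.filter fun j => (F j).Adj y s.2).card = J.card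
        → (J.filter fun j => (F j).Adj x s.1) = J ∧ (J.filter fun j => (F j).Adj y s.2) = ∅ ∨
          (J.filter fun j => (F j).Adj x s.1) = ∅ ∧ (J.filter fun j => (F j).Adj y s.2) = J) := by
    intro s hs
    refine card_add_card_le_of_cross (Finset.filter_subset _ _) (Finset.filter_subset _ _) ?_
      (by omega)
    intro i hi j hj
    rw [Finset.mem_filter] at hi hj
    exact h.eq_of_cross ((hJ i).1 hi.1) ((hJ j).1 hj.1) (by rwa [hS, List.mem_toFinset] at hs) hi.2 hj.2
  -- Slots are counted against unused colours. The Ore condition bounds the sum from below, colour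
  -- by colour, and the crossing lemma from above, slot by slot, both by `S.card * J.card`; hence
  -- every slot is tight.
  have hdc : ∑ s ∈ S, ((J.filter fun j => (F j).Adj x s.1).card +
      (J.filter fun j => (F j).Adj y s.2).card) = ∑ j ∈ J,
      ((S.filter fun s => (F j).Adj x s.1).card + (S.filter fun s => (F j).Adj y s.2).card) := by
    simp only [Finset.card_filter, Finset.sum_add_distrib]
    rw [Finset.sum_comm, Finset.sum_comm (s := S) (t := J)]
  have hle : ∑ s ∈ S, J.card ≤ ∑ s ∈ S, ((J.filter fun j => (F j).Adj x s.1).card +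
      (J.filter fun j => (F j).Adj y s.2).card) := by
    rw [hdc]
    calc ∑ s ∈ S, J.card = ∑ j ∈ J, S.card := by simp [mul_comm]
      _ ≤ _ := Finset.sum_le_sum hlow
  have heq : ∀ s ∈ S, (J.filter fun j => (F j).Adj x s.1).card +
      (J.filter fun j => (F j).Adj y s.2).card = J.card :=
    (Finset.sum_eq_sum_iff_of_le fun s hs => (hup s hs).1).1
      (le_antisymm (Finset.sum_le_sum fun s hs => (hup s hs).1) hle)
  have hslot : ∀ q q', (q, q') ∈ K.flatMap slots →
      (∀ j, Unused K col j → (F j).Adj x q ∧ ¬ (F j).Adj y q') ∨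
      (∀ j, Unused K col j → ¬ (F j).Adj x q ∧ (F j).Adj y q') := by
    intro q q' hq
    have hs : (q, q') ∈ S := by simpa [hS] using hq
    rcases (hup _ hs).2 (heq _ hs) with ⟨h1, h2⟩ | ⟨h1, h2⟩
    · left
      intro j hj
      rw [Finset.filter_eq_self] at h1
      rw [Finset.filter_eq_empty_iff] at h2
      exact ⟨h1 j ((hJ j).2 hj), h2 ((hJ j).2 hj)⟩
    · right
      intro j hj
      rw [Finset.filter_eq_self] at h2
      rw [Finset.filter_eq_empty_iff] at h1
      exact ⟨h1 ((hJ j).2 hj), h2 j ((hJ j).2 hj)⟩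
  refine ⟨hslot, ?_⟩
  obtain ⟨j, hj⟩ : J.Nonempty := Finset.card_pos.1 (by omega)
  refine ⟨j, (hJ j).1 hj, ?_⟩
  -- At each slot only one of the two adjacencies holds, so the degree sum is at most the number of
  -- slots.
  have h1 : (S.filter fun s => (F j).Adj x s.1).card +
      (S.filter fun s => (F j).Adj y s.2).card ≤ S.card := by
    rw [← Finset.card_union_of_disjoint]
    · exact Finset.card_le_card (Finset.union_subset (Finset.filter_subset _ _)
        (Finset.filter_subset _ _))
    · rw [Finset.disjoint_filter]
      rintro ⟨q, q'⟩ hs h1 h2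
      rcases hslot q q' (by simpa [hS] using hs) with h3 | h3
      · exact (h3 j ((hJ j).1 hj)).2 h2
      · exact (h3 j ((hJ j).1 hj)).1 h1
  have h2 := hx j hj
  have h3 := hy j hj
  omega

end IsMinCover

end RainbowOre

/-! ### The alternating and split structures seen from the ends of a minimum cover. -/

namespace RainbowOre

section Lists

variable {α : Type*}

theorem slots_append_cons (A B : List α) (x : α) :
    slots (A ++ x :: B) = slots (A ++ [x]) ++ slots (x :: B) := by
  cases B with
  | nil => simp
  | cons b B => simp [slots_append_cons_cons]

theorem mem_of_mem_slots_concat {P : List α} {a q q' : α} (h : (q, q') ∈ slots (P ++ [a])) :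
    q ∈ P := by
  obtain ⟨R, S, hRS⟩ := mem_slots.1 h
  obtain ⟨S', b, hb⟩ := (List.eq_nil_or_concat (q' :: S)).resolve_left (by simp)
  rw [hb, List.concat_eq_append] at hRS
  have : P ++ [a] = (R ++ q :: S') ++ [b] := by simpa using hRS
  rw [List.append_inj_left' this rfl]
  simp

theorem exists_isEnd {l : List α} (hl : l ≠ []) : ∃ x, IsEnd x l := by
  obtain ⟨P, x, rfl⟩ := (List.eq_nil_or_concat l).resolve_left hl
  exact ⟨x, by simpa using isEnd_concat x P⟩

/-- The crossed complements carry agreement of `f` and `g` from each entry to the next. -/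
theorem iff_of_slots {f g : α → Prop} {l : List α}
    (h : ∀ q q', (q, q') ∈ slots l → (f q ↔ ¬ g q') ∧ (g q ↔ ¬ f q'))
    (h0 : ∀ z Q, l = z :: Q → (f z ↔ g z)) : ∀ z ∈ l, (f z ↔ g z) := by
  induction l with
  | nil => simp
  | cons a l ih => cases l with
    | nil => simpa using h0 a [] rfl
    | cons b l =>
      intro z hz
      rcases List.mem_cons.1 hz with rfl | hz
      · exact h0 z _ rfl
      · refine ih (fun q q' hq => h q q' (by simp [hq])) ?_ z hz
        intro z' Q hQ
        obtain ⟨rfl, rfl⟩ := List.cons.inj hQ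
        have h1 := h a b (by simp)
        have h2 := h0 a _ rfl
        tauto

theorem exists_perm_cons_cons {l : α} {L : List α} (hl : l ∈ L) (hL : 2 ≤ L.length) :
    ∃ l' L', L.Perm (l :: l' :: L') := by
  obtain ⟨L', h⟩ := exists_perm_cons hl
  cases L' with
  | nil => simp [h.length_eq] at hL
  | cons a L' => exact ⟨a, L', h⟩

theorem exists_perm_cons_cons_cons {l : α} {L : List α} (hl : l ∈ L) (hL : 3 ≤ L.length) :
    ∃ l₁ l₂ L', L.Perm (l :: l₁ :: l₂ :: L') := by
  obtain ⟨a, L', h⟩ := exists_perm_cons_cons hl (by omega)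
  cases L' with
  | nil => simp [h.length_eq] at hL
  | cons b L' => exact ⟨a, b, L', h⟩

end Lists

variable {U ι : Type*}

/-- Membership in `T` alternates along the path `l`, whose ends are not in `T`. -/
def IsAltPath (T : Set U) (l : List U) : Prop :=
  (∀ q q', (q, q') ∈ slots l → (q ∈ T ↔ q' ∉ T)) ∧ ∀ x, IsEnd x l → x ∉ T

/-- All paths alternate with respect to `T`, and `T` is the neighbourhood of every end. -/
def IsAlternating (F : SimpleGraph U) (L : List (List U)) (T : Set U) : Prop :=
  ∀ l ∈ L, IsAltPath T l ∧ ∀ x, IsEnd x l → ∀ z, F.Adj x z ↔ z ∈ T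

/-- The neighbourhood of every end is the rest of its path. -/
def IsSplit (F : SimpleGraph U) (L : List (List U)) : Prop :=
  ∀ l ∈ L, ∀ x, IsEnd x l → ∀ z, F.Adj x z ↔ z ∈ l ∧ z ≠ x

variable [Fintype U] [Fintype ι] [DecidableEq U]
  {F : ι → SimpleGraph U} [∀ i, DecidableRel (F i).Adj] {m : ℕ}
  {L L' : List (List U)} {col col' : Sym2 U → ι} {l l' D A B : List U} {x y z q q' : U} {j : ι}

namespace IsMinCover

/-- Provides a colour for an exchange while the colour under study stays unused. -/
theorem exists_unused_ne (h : IsMinCover F m L col) (j : ι) : ∃ i, i ≠ j ∧ Unused L col i := by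
  classical
  have hc := h.card_unused (J := Finset.univ.filter (Unused L col)) (by simp)
  obtain ⟨i, hi, hij⟩ := Finset.exists_mem_ne (a := j)
    (s := Finset.univ.filter (Unused L col)) (by omega)
  exact ⟨i, hij, by simpa using hi⟩

/-- `cross` asks for `y` as a first vertex. Reversing `l'` reaches its other end and disturbs only
the slots of `l'`, which are therefore left out. -/
theorem cross_ends (h : IsMinCover F m (l :: l' :: L) col) (hx : l = A ++ [x]) (hy : IsEnd y l') :
    (∀ q q', ((q, q') ∈ slots l ∨ ∃ D ∈ L, (q, q') ∈ slots D) →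
      (∀ j, Unused (l :: l' :: L) col j → (F j).Adj x q ∧ ¬ (F j).Adj y q') ∨
      (∀ j, Unused (l :: l' :: L) col j → ¬ (F j).Adj x q ∧ (F j).Adj y q')) ∧
    ∃ j, Unused (l :: l' :: L) col j ∧
      (F j).degree x + (F j).degree y + m ≤ Fintype.card U := by
  subst hx
  have key : ∀ l'', IsMinCover F m ((A ++ [x]) :: l'' :: L) col → (∃ B, l'' = y :: B) →
      (∀ q q', ((q, q') ∈ slots (A ++ [x]) ∨ ∃ D ∈ L, (q, q') ∈ slots D) →
      (∀ j, Unused ((A ++ [x]) :: l'' :: L) col j → (F j).Adj x q ∧ ¬ (F j).Adj y q') ∨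
      (∀ j, Unused ((A ++ [x]) :: l'' :: L) col j → ¬ (F j).Adj x q ∧ (F j).Adj y q')) ∧
      ∃ j, Unused ((A ++ [x]) :: l'' :: L) col j ∧
      (F j).degree x + (F j).degree y + m ≤ Fintype.card U := by
    rintro _ h' ⟨B, rfl⟩
    refine ⟨fun q q' hq => h'.cross.1 q q' ?_, h'.cross.2⟩
    simp only [List.mem_flatMap, List.mem_cons]
    rcases hq with hq | ⟨D, hD, hq⟩
    · exact ⟨_, Or.inl rfl, hq⟩
    · exact ⟨D, Or.inr (Or.inr hD), hq⟩
  rcases hy with hy | ⟨P, hy⟩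
  · exact key _ h hy
  · have hu : ∀ j, Unused ((A ++ [x]) :: l' :: L) col j ↔
        Unused ((A ++ [x]) :: l'.reverse :: L) col j := by simp [Unused]
    simp only [hu]
    exact key _ (((h.perm (.swap _ _ _)).reverse).perm (.swap _ _ _))
      ⟨P.reverse, by simp [hy]⟩

theorem slot_iff (h : IsMinCover F m (l :: l' :: L) col) (hj : Unused (l :: l' :: L) col j)
    (hx : l = A ++ [x]) (hy : IsEnd y l') (hq : (q, q') ∈ slots l) :
    (F j).Adj x q ↔ ¬ (F j).Adj y q' := by
  rcases (h.cross_ends hx hy).1 q q' (Or.inl hq) with h1 | h1 <;> have := h1 j hj <;> tauto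

theorem adj_congr_of_cons (h : IsMinCover F m (l :: l' :: L) col) (hx : IsEnd x l) {i : ι}
    (hj : Unused (l :: l' :: L) col j) (hi : Unused (l :: l' :: L) col i) (z : U) :
    (F j).Adj x z ↔ (F i).Adj x z := by
  wlog hx' : ∃ A, l = A ++ [x] generalizing l
  · refine this h.reverse (isEnd_reverse.2 hx) hj.reverse hi.reverse ?_
    obtain ⟨Q, rfl⟩ := hx.resolve_right hx'
    exact ⟨Q.reverse, by simp⟩
  obtain ⟨A, rfl⟩ := hx'
  obtain ⟨y, B, rfl⟩ := List.exists_cons_of_ne_nil (h.ne_nil_of_mem (l := l') (by simp))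
  obtain ⟨D, hD, hz⟩ := h.exists_mem z
  -- At a slot starting in `z` the alternative of `cross` is common to all unused colours. A vertex
  -- starting no slot is last on its path, and there both sides are false.
  rcases exists_slot_left hz with ⟨P, rfl⟩ | ⟨q', hq⟩
  · rcases List.mem_cons.1 hD with hP | hD'
    · have : z = x := by simpa using congrArg List.getLast? hP
      subst this
      simp
    · obtain ⟨K, hK⟩ := exists_perm_cons hD'
      have h' := h.perm (hK.cons _)
      exact iff_of_false (h'.not_adj_ends (hj.perm (hK.cons _)) hx (isEnd_concat z P))
        (h'.not_adj_ends (hi.perm (hK.cons _)) hx (isEnd_concat z P))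
  · rcases h.cross.1 z q' (List.mem_flatMap.2 ⟨_, hD, hq⟩) with h1 | h1
    · exact iff_of_true (h1 j hj).1 (h1 i hi).1
    · exact iff_of_false (h1 j hj).1 (h1 i hi).1

/-- The neighbourhood of an end is the same in all unused colours. -/
theorem adj_congr (h : IsMinCover F m L col) (hm : 2 ≤ m) (hl : l ∈ L) (hx : IsEnd x l) {i : ι}
    (hj : Unused L col j) (hi : Unused L col i) (z : U) : (F j).Adj x z ↔ (F i).Adj x z := by
  obtain ⟨l', L', hL⟩ := exists_perm_cons_cons hl (by rw [h.length_eq]; exact hm)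
  exact (h.perm hL).adj_congr_of_cons hx (hj.perm hL) (hi.perm hL) z

/-- If the neighbours of an end `y` alternate on another path, then the ends of that path have the
same neighbours on it. -/
theorem adj_iff_of_alternating (h : IsMinCover F m (l :: l' :: L) col)
    (hj : Unused (l :: l' :: L) col j) (hx : IsEnd x l) (hy : IsEnd y l')
    (halt : ∀ q q', (q, q') ∈ slots l → ((F j).Adj y q ↔ ¬ (F j).Adj y q')) :
    ∀ z ∈ l, ((F j).Adj x z ↔ (F j).Adj y z) := by
  intro z hz
  wlog hx' : ∃ A, l = A ++ [x] generalizing l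
  · refine this h.reverse hj.reverse (isEnd_reverse.2 hx) ?_ (by simpa using hz) ?_
    · intro q q' hq
      have := halt q' q (mem_slots_reverse.1 hq)
      tauto
    · obtain ⟨Q, rfl⟩ := hx.resolve_right hx'
      exact ⟨Q.reverse, by simp⟩
  obtain ⟨A, hA⟩ := hx'
  rcases exists_slot_left hz with ⟨P, hP⟩ | ⟨q', hq⟩
  · have : z = x := by simpa using congrArg List.getLast? (hP.symm.trans hA)
    subst this
    have := h.not_adj_ends hj hx hy
    exact iff_of_false (by simp) (fun h' => this h'.symm)
  -- The crossing complements the adjacency of `y` to the next vertex, and alternation complements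
  -- it back.
  · have h1 := h.slot_iff hj hA hy hq
    have h2 := halt z q' hq
    tauto

section ThreePaths

/-- On a third path the crossing relation holds for either end of `l`, because reversing `l` leaves
the slots of `D` in place. -/
theorem slot_iff_third (h : IsMinCover F m (l :: l' :: D :: L) col)
    (hj : Unused (l :: l' :: D :: L) col j) (hx : IsEnd x l) (hy : IsEnd y l')
    (hq : (q, q') ∈ slots D) : (F j).Adj x q ↔ ¬ (F j).Adj y q' := by
  wlog hx' : ∃ A, l = A ++ [x] generalizing l
  · refine this h.reverse hj.reverse (isEnd_reverse.2 hx) ?_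
    obtain ⟨Q, rfl⟩ := hx.resolve_right hx'
    exact ⟨Q.reverse, by simp⟩
  obtain ⟨A, hA⟩ := hx'
  rcases (h.cross_ends hA hy).1 q q' (Or.inr ⟨D, by simp, hq⟩) with h1 | h1 <;>
    have := h1 j hj <;> tauto

/-- The crossing relation holds with `x` and `y` in both roles, and neither is adjacent to the first
vertex of `D`. Agreement spreads from there along `D`, and then the crossing relation becomes
alternation. -/
theorem adj_iff_third (h : IsMinCover F m (l :: l' :: D :: L) col)
    (hj : Unused (l :: l' :: D :: L) col j) (hx : IsEnd x l) (hy : IsEnd y l') :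
    (∀ z ∈ D, ((F j).Adj x z ↔ (F j).Adj y z)) ∧
      ∀ q q', (q, q') ∈ slots D → ((F j).Adj x q ↔ ¬ (F j).Adj x q') := by
  have hp := List.Perm.swap l' l (D :: L)
  have hs : ∀ q q', (q, q') ∈ slots D → ((F j).Adj x q ↔ ¬ (F j).Adj y q') ∧
      ((F j).Adj y q ↔ ¬ (F j).Adj x q') := fun q q' hq =>
    ⟨h.slot_iff_third hj hx hy hq, (h.perm hp).slot_iff_third (hj.perm hp) hy hx hq⟩
  have hxy : ∀ z ∈ D, ((F j).Adj x z ↔ (F j).Adj y z) := by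
    refine iff_of_slots hs ?_
    rintro z Q hQ
    have hz : IsEnd z D := Or.inl ⟨Q, hQ⟩
    have hp1 : (l :: l' :: D :: L).Perm (l :: D :: l' :: L) := (List.Perm.swap _ _ _).cons _
    have hp2 : (l :: l' :: D :: L).Perm (l' :: D :: l :: L) :=
      (List.Perm.swap _ _ _).trans ((List.Perm.swap _ _ _).cons _)
    exact iff_of_false ((h.perm hp1).not_adj_ends (hj.perm hp1) hx hz)
      ((h.perm hp2).not_adj_ends (hj.perm hp2) hy hz)
  refine ⟨hxy, fun q q' hq => ?_⟩
  have h1 := (hs q q' hq).1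
  have h2 := hxy q' (mem_of_mem_slots hq).2
  tauto

/-- Seen from `l'` and `D`, the path `l` is itself a third path, so the neighbours of `y` alternate
on it. -/
theorem adj_iff_of_mem_first (h : IsMinCover F m (l :: l' :: D :: L) col)
    (hj : Unused (l :: l' :: D :: L) col j) (hx : IsEnd x l) (hy : IsEnd y l') :
    ∀ z ∈ l, ((F j).Adj x z ↔ (F j).Adj y z) := by
  obtain ⟨w, hw⟩ := exists_isEnd (h.ne_nil_of_mem (l := D) (by simp))
  have hp : (l :: l' :: D :: L).Perm (l' :: D :: l :: L) :=
    (List.Perm.swap _ _ _).trans ((List.Perm.swap _ _ _).cons _)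
  exact h.adj_iff_of_alternating hj hx hy ((h.perm hp).adj_iff_third (hj.perm hp) hy hw).2

theorem adj_iff_of_three (h : IsMinCover F m (l :: l' :: D :: L) col)
    (hj : Unused (l :: l' :: D :: L) col j) (hx : IsEnd x l) (hy : IsEnd y l') (z : U) :
    (F j).Adj x z ↔ (F j).Adj y z := by
  obtain ⟨l₀, hl₀, hz⟩ := h.exists_mem z
  rcases List.mem_cons.1 hl₀ with rfl | hl₀
  · exact h.adj_iff_of_mem_first hj hx hy z hz
  rcases List.mem_cons.1 hl₀ with rfl | hl₀
  · have hp := List.Perm.swap l₀ l (D :: L)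
    exact ((h.perm hp).adj_iff_of_mem_first (hj.perm hp) hy hx z hz).symm
  · obtain ⟨K, hK⟩ := exists_perm_cons hl₀
    have hp := (hK.cons l').cons l
    exact ((h.perm hp).adj_iff_third (hj.perm hp) hx hy).1 z hz

/-- All ends share one neighbourhood, and it serves as `T`. Two ends of the same path are compared
through an end of another. -/
theorem exists_isAlternating_of_three (h : IsMinCover F m L col) (hm : 3 ≤ m)
    (hj : Unused L col j) : ∃ T, IsAlternating (F j) L T := by
  have hlen : 3 ≤ L.length := by rw [h.length_eq]; exact hm
  have key : ∀ l ∈ L, ∀ l' ∈ L, ∀ x y, IsEnd x l → IsEnd y l' → ∀ z,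
      ((F j).Adj x z ↔ (F j).Adj y z) := by
    intro l hl l' hl' x y hx hy z
    obtain ⟨l₁, l₂, K, hK⟩ := exists_perm_cons_cons_cons hl hlen
    rcases List.mem_cons.1 (hK.mem_iff.1 hl') with rfl | hl'
    · obtain ⟨w, hw⟩ := exists_isEnd ((h.perm hK).ne_nil_of_mem (l := l₁) (by simp))
      exact ((h.perm hK).adj_iff_of_three (hj.perm hK) hx hw z).trans
        ((h.perm hK).adj_iff_of_three (hj.perm hK) hy hw z).symm
    · obtain ⟨l₃, K', hK'⟩ := exists_perm_cons_cons hl' (by simp)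
      have hp := hK.trans (hK'.cons l)
      exact (h.perm hp).adj_iff_of_three (hj.perm hp) hx hy z
  obtain ⟨l₀, hl₀⟩ := List.exists_mem_of_length_pos (by omega : 0 < L.length)
  obtain ⟨x₀, hx₀⟩ := exists_isEnd (h.ne_nil_of_mem hl₀)
  refine ⟨{z | (F j).Adj x₀ z}, fun l hl => ⟨⟨?_, ?_⟩, ?_⟩⟩
  · intro q q' hq
    obtain ⟨l₁, l₂, K, hK⟩ := exists_perm_cons_cons_cons hl hlen
    have hp : L.Perm (l₁ :: l₂ :: l :: K) :=
      hK.trans ((List.Perm.swap _ _ _).trans ((List.Perm.swap _ _ _).cons _))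
    obtain ⟨x, hx⟩ := exists_isEnd ((h.perm hp).ne_nil_of_mem (l := l₁) (by simp))
    obtain ⟨y, hy⟩ := exists_isEnd ((h.perm hp).ne_nil_of_mem (l := l₂) (by simp))
    have h1 := ((h.perm hp).adj_iff_third (hj.perm hp) hx hy).2 q q' hq
    have hl₁ : l₁ ∈ L := hp.mem_iff.2 (by simp)
    have h2 := key l₁ hl₁ l₀ hl₀ x x₀ hx hx₀
    simp only [Set.mem_ofPred_eq]
    rw [← h2 q, ← h2 q']
    exact h1
  · intro x hx hT
    exact (F j).irrefl ((key l hl l₀ hl₀ x x₀ hx hx₀ x).2 hT)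
  · intro x hx z
    exact key l hl l₀ hl₀ x x₀ hx hx₀ z

end ThreePaths

section TwoPaths

/-- Both ends of a path have the same neighbours on the other path. -/
theorem adj_iff_other (h : IsMinCover F m [A, B] col) (hj : Unused [A, B] col j)
    {y' : U} (hy : IsEnd y B) (hy' : IsEnd y' B) : ∀ z ∈ A, ((F j).Adj y z ↔ (F j).Adj y' z) := by
  intro z hz
  rcases exists_slot_right hz with ⟨Q, hQ⟩ | ⟨q, hq⟩
  · exact iff_of_false (fun h' => h.not_adj_ends hj (Or.inl ⟨Q, hQ⟩) hy h'.symm)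
      (fun h' => h.not_adj_ends hj (Or.inl ⟨Q, hQ⟩) hy' h'.symm)
  · obtain ⟨A', x, hx⟩ := (List.eq_nil_or_concat A).resolve_left (h.ne_nil_of_mem (by simp))
    rw [List.concat_eq_append] at hx
    -- Both ends of `B` are crossed with the same end `x` of `A` at the same slot.
    have h1 := h.slot_iff hj hx hy hq
    have h2 := h.slot_iff hj hx hy' hq
    tauto

/-- The edge `ya` replaces the edge entering `a`. That edge exists because `a`, being adjacent to an
end of the other path, is not an end itself. -/
theorem exists_attach_two {P Q : List U} {a : U}
    (h : IsMinCover F m [P ++ a :: Q, B ++ [y]] col) (hm : 2 ≤ m)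
    (hj : Unused [P ++ a :: Q, B ++ [y]] col j) (hya : (F j).Adj y a) :
    ∃ col', IsMinCover F m [P, B ++ y :: a :: Q] col' ∧ Unused [P, B ++ y :: a :: Q] col' j := by
  obtain ⟨P', p, rfl⟩ : ∃ P' p, P = P' ++ [p] := by
    rcases List.eq_nil_or_concat P with rfl | ⟨P', p, hP⟩
    · exact absurd hya.symm (h.not_adj_ends hj (isEnd_cons a Q) (isEnd_concat y B))
    · exact ⟨P', p, by simpa using hP⟩
  -- The new edge is coloured `i` instead of `j`, which is possible as the end `y` has the same
  -- neighbours in both; thus `j` remains unused.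
  obtain ⟨i, hij, hi⟩ := h.exists_unused_ne j
  have hya' : (F i).Adj y a := (h.adj_congr hm (by simp) (isEnd_concat y B) hj hi a).1 hya
  have e1 : (P' ++ [p] ++ a :: Q).reverse = Q.reverse ++ a :: p :: P'.reverse := by simp
  have h' := h.reverse.swap_two
  have hj' := hj.reverse.swap_two
  have hi' := hi.reverse.swap_two
  rw [e1] at h' hj' hi'
  obtain ⟨col', hc, hu⟩ := h'.toIsRainbowCover.attach hi' hya'
  have h2 := (h'.of_cover hc rfl).swap_two.reverse
  have hu2 := (hu j (Or.inr ⟨hj', hij.symm⟩)).swap_two.reverse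
  refine ⟨col', by simpa using h2, by simpa using hu2⟩

/-- After attaching, the last vertex x of the first path and the first vertex y' of the second are
the two ends of one path, so they see the same vertices of `P`. In the old cover y' and `y` agree
there, and x and `y` are complementary across each slot; together this is alternation for `y`. -/
theorem alternating_of_adj_aux {P Q : List U} {a : U}
    (h : IsMinCover F m [P ++ a :: Q, B ++ [y]] col) (hm : 2 ≤ m)
    (hj : Unused [P ++ a :: Q, B ++ [y]] col j) (hya : (F j).Adj y a) :
    ∀ q q', (q, q') ∈ slots (P ++ [a]) → ((F j).Adj y q ↔ ¬ (F j).Adj y q') := by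
  obtain ⟨col', h', hj'⟩ := h.exists_attach_two hm hj hya
  intro q q' hq
  have hqP := mem_of_mem_slots_concat hq
  obtain ⟨R, x, hR⟩ := (List.eq_nil_or_concat (a :: Q)).resolve_left (by simp)
  rw [List.concat_eq_append] at hR
  obtain ⟨y', B', hB⟩ : ∃ y' B', B ++ [y] = y' :: B' :=
    List.exists_cons_of_ne_nil (by simp)
  have h1 := h'.adj_iff_other hj' (y := x) (y' := y')
    (Or.inr ⟨B ++ y :: R, by simp [hR]⟩)
    (Or.inl ⟨B' ++ a :: Q, by rw [← List.cons_append, ← hB]; simp⟩) q hqP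
  have h2 := h.adj_iff_other hj (isEnd_concat y B) (y' := y') (Or.inl ⟨B', hB⟩) q (by simp [hqP])
  have h3 := h.slot_iff hj (x := x) (A := P ++ R) (by simp [hR]) (isEnd_concat y B)
    (q := q) (q' := q') (by rw [slots_append_cons]; simp [hq])
  tauto

/-- If an end `y` has a neighbour on the other path, then its neighbours alternate there. -/
theorem alternating_of_adj (h : IsMinCover F m [A, B] col) (hm : 2 ≤ m)
    (hj : Unused [A, B] col j) (hy : IsEnd y B) {a : U} (ha : a ∈ A) (hya : (F j).Adj y a) :
    ∀ q q', (q, q') ∈ slots A → ((F j).Adj y q ↔ ¬ (F j).Adj y q') := by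
  obtain ⟨B', w, hB⟩ := (List.eq_nil_or_concat B).resolve_left (h.ne_nil_of_mem (by simp))
  rw [List.concat_eq_append] at hB
  have hw := h.adj_iff_other hj hy (Or.inr ⟨B', hB⟩)
  obtain ⟨P, Q, rfl⟩ := List.append_of_mem ha
  have hwa := (hw a ha).1 hya
  subst hB
  intro q q' hq
  rw [hw q (mem_of_mem_slots hq).1, hw q' (mem_of_mem_slots hq).2]
  rw [slots_append_cons, List.mem_append] at hq
  rcases hq with hq | hq
  · exact h.alternating_of_adj_aux hm hj hwa q q' hq
  · have h' := h.reverse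
    have hj' := hj.reverse
    have e : (P ++ a :: Q).reverse = Q.reverse ++ a :: P.reverse := by simp
    rw [e] at h' hj'
    have := h'.alternating_of_adj_aux hm hj' hwa q' q (by
      rw [← mem_slots_reverse]; simpa using hq)
    tauto

/-- One adjacency from an end to the other path makes its neighbours alternate there. An exchange
carries the alternation back to its own path, after which all four ends have the same neighbourhood.
-/
theorem exists_isAlternating_of_adj (h : IsMinCover F m [A, B] col) (hm : 2 ≤ m)
    (hj : Unused [A, B] col j) (hy : IsEnd y B) {a : U} (ha : a ∈ A) (hya : (F j).Adj y a) :
    ∃ T, IsAlternating (F j) [A, B] T := by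
  wlog hB : ∃ B', B = B' ++ [y] generalizing y
  · obtain ⟨B', w, hB⟩ := (List.eq_nil_or_concat B).resolve_left (h.ne_nil_of_mem (by simp))
    rw [List.concat_eq_append] at hB
    have hw : IsEnd w B := Or.inr ⟨B', hB⟩
    exact this hw ((h.adj_iff_other hj hy hw a ha).1 hya) ⟨B', hB⟩
  obtain ⟨B', rfl⟩ := hB
  have haltA := h.alternating_of_adj hm hj hy ha hya
  have hA : ∀ x, IsEnd x A → ∀ z ∈ A, ((F j).Adj x z ↔ (F j).Adj y z) := fun x hx =>
    h.adj_iff_of_alternating hj hx hy haltA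
  obtain ⟨x, A', hxA⟩ := List.exists_cons_of_ne_nil (h.ne_nil_of_mem (l := A) (by simp))
  have hx : IsEnd x A := Or.inl ⟨A', hxA⟩
  -- After attaching at `a`, all of `B' ++ [y]` lies with `a` on the path opposite to `x`, and `x`
  -- is adjacent to `a`; so the neighbours of `x` alternate along it.
  have haltB : ∀ q q', (q, q') ∈ slots (B' ++ [y]) → ((F j).Adj x q ↔ ¬ (F j).Adj x q') := by
    intro q q' hq
    obtain ⟨P, Q, rfl⟩ := List.append_of_mem ha
    obtain ⟨col', h', hj'⟩ := h.exists_attach_two hm hj hya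
    refine h'.swap_two.alternating_of_adj hm hj'.swap_two (y := x) ?_ (a := a) (by simp)
      ((hA x hx a ha).2 hya) q q' (by rw [slots_append_cons]; simp [hq])
    cases P with
    | nil => exact absurd hya.symm (h.not_adj_ends hj (isEnd_cons a Q) (isEnd_concat y B'))
    | cons p P =>
      simp only [List.cons_append, List.cons.injEq] at hxA
      rw [hxA.1]
      exact isEnd_cons x P
  refine ⟨{z | (F j).Adj x z}, ?_⟩
  intro l hl
  simp only [List.mem_cons, List.not_mem_nil, or_false] at hl
  rcases hl with rfl | rfl
  · refine ⟨⟨?_, ?_⟩, ?_⟩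
    · intro q q' hq
      have h1 := hA x hx q (mem_of_mem_slots hq).1
      have h2 := hA x hx q' (mem_of_mem_slots hq).2
      have h3 := haltA q q' hq
      simp only [Set.mem_ofPred_eq]
      tauto
    · intro w hw hT
      exact h.not_adj_ends hj hw hy ((hA x hx w hw.mem).1 hT).symm
    · intro w hw z
      obtain ⟨l', hl', hz⟩ := h.exists_mem z
      simp only [List.mem_cons, List.not_mem_nil, or_false] at hl'
      rcases hl' with rfl | rfl
      · exact (hA w hw z hz).trans (hA x hx z hz).symm
      · exact h.swap_two.adj_iff_other hj.swap_two hw hx z hz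
  · refine ⟨⟨fun q q' hq => haltB q q' hq, ?_⟩, ?_⟩
    · intro w hw hT
      exact h.not_adj_ends hj hx hw hT
    · intro w hw z
      obtain ⟨l', hl', hz⟩ := h.exists_mem z
      simp only [List.mem_cons, List.not_mem_nil, or_false] at hl'
      rcases hl' with rfl | rfl
      · exact (h.adj_iff_other hj hw hy z hz).trans (hA x hx z hz).symm
      · exact h.swap_two.adj_iff_of_alternating hj.swap_two hw hx haltB z hz

/-- At each slot of `A` the end of `B` is not adjacent to the second entry, so the crossing relation
makes the last vertex of `A` adjacent to the first entry. -/
theorem isSplit_of_not_adj (h : IsMinCover F m [A, B] col) (hj : Unused [A, B] col j)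
    (hA : ∀ x, IsEnd x A → ∀ z ∈ B, ¬ (F j).Adj x z)
    (hB : ∀ y, IsEnd y B → ∀ z ∈ A, ¬ (F j).Adj y z) (hx : IsEnd x A) (z : U) :
    (F j).Adj x z ↔ z ∈ A ∧ z ≠ x := by
  wlog hx' : ∃ A', A = A' ++ [x] generalizing A
  · have := this h.reverse hj.reverse (fun x hx => hA x (isEnd_reverse.1 hx))
      (fun y hy z hz => hB y hy z (by simpa using hz)) (isEnd_reverse.2 hx) (by
      obtain ⟨Q, rfl⟩ := hx.resolve_right hx'
      exact ⟨Q.reverse, by simp⟩)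
    simpa using this
  obtain ⟨A', hA'⟩ := hx'
  constructor
  · intro hz
    refine ⟨?_, hz.ne'⟩
    obtain ⟨l, hl, hzl⟩ := h.exists_mem z
    simp only [List.mem_cons, List.not_mem_nil, or_false] at hl
    rcases hl with rfl | rfl
    · exact hzl
    · exact absurd hz (hA x hx z hzl)
  · rintro ⟨hz, hne⟩
    rcases exists_slot_left hz with ⟨P, hP⟩ | ⟨q', hq⟩
    · exact absurd (by simpa using congrArg List.getLast? (hP.symm.trans hA')) hne
    · obtain ⟨y, hy⟩ := exists_isEnd (h.ne_nil_of_mem (l := B) (by simp))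
      exact (h.slot_iff hj hA' hy hq).2 (hB y hy q' (mem_of_mem_slots hq).2)

end TwoPaths

/-- For two paths the question is whether some end has a neighbour on the other path; three or more
paths always alternate. -/
theorem alternating_or_split (h : IsMinCover F m L col) (hm : 2 ≤ m) (hj : Unused L col j) :
    (∃ T, IsAlternating (F j) L T) ∨ m = 2 ∧ IsSplit (F j) L := by
  rcases hm.eq_or_lt with rfl | hm'
  · obtain ⟨A, B, rfl⟩ := List.length_eq_two.1 h.length_eq
    by_cases hB : ∃ y, IsEnd y B ∧ ∃ z ∈ A, (F j).Adj y z
    · obtain ⟨y, hy, a, ha, hya⟩ := hB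
      exact Or.inl (h.exists_isAlternating_of_adj hm hj hy ha hya)
    by_cases hA : ∃ x, IsEnd x A ∧ ∃ z ∈ B, (F j).Adj x z
    · obtain ⟨y, hy, a, ha, hya⟩ := hA
      obtain ⟨T, hT⟩ := h.swap_two.exists_isAlternating_of_adj hm hj.swap_two hy ha hya
      refine Or.inl ⟨T, fun l hl => hT l ?_⟩
      simp only [List.mem_cons, List.not_mem_nil, or_false] at hl ⊢
      tauto
    push Not at hA hB
    refine Or.inr ⟨rfl, fun l hl x hx z => ?_⟩
    simp only [List.mem_cons, List.not_mem_nil, or_false] at hl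
    rcases hl with rfl | rfl
    · exact h.isSplit_of_not_adj hj hA hB hx z
    · exact h.swap_two.isSplit_of_not_adj hj.swap_two hB hA hx z
  · exact Or.inl (h.exists_isAlternating_of_three hm' hj)

end IsMinCover

end RainbowOre

/-! ### Spreading the structure to all vertices and all colours. -/

namespace RainbowOre

variable {U ι : Type*} [Fintype U] [Fintype ι] [DecidableEq U]
  {F : ι → SimpleGraph U} [∀ i, DecidableRel (F i).Adj] {m : ℕ}
  {L : List (List U)} {col : Sym2 U → ι} {l : List U} {y z q : U} {i j : ι} {T : Set U}

namespace IsMinCover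

theorem isAlternating_congr (h : IsMinCover F m L col) (hm : 2 ≤ m) (hj : Unused L col j)
    (hi : Unused L col i) (hT : IsAlternating (F j) L T) : IsAlternating (F i) L T :=
  fun l hl => ⟨(hT l hl).1, fun x hx z =>
    (h.adj_congr hm hl hx hi hj z).trans ((hT l hl).2 x hx z)⟩

theorem isSplit_congr (h : IsMinCover F m L col) (hm : 2 ≤ m) (hj : Unused L col j)
    (hi : Unused L col i) (hS : IsSplit (F j) L) : IsSplit (F i) L :=
  fun l hl x hx z => (h.adj_congr hm hl hx hi hj z).trans (hS l hl x hx z)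

/-- Every vertex `y` next to a vertex of `T` becomes an end of another cover which alternates with
respect to the same set. -/
theorem exists_alternating_end (h : IsMinCover F m L col) (hm : 2 ≤ m) (hi : Unused L col i)
    (hT : IsAlternating (F i) L T) (hl : l ∈ L) (hs : (q, y) ∈ slots l ∨ (y, q) ∈ slots l)
    (hq : q ∈ T) :
    ∃ L' col', IsMinCover F m L' col' ∧ (∃ l' ∈ L', IsEnd y l') ∧
      Unused L' col' (col s(q, y)) ∧ (∀ j, j ≠ i → Unused L col j → Unused L' col' j) ∧
      ∀ j, Unused L' col' j → IsAlternating (F j) L' T := by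
  obtain ⟨l', K, hL⟩ := exists_perm_cons_cons hl (by rw [h.length_eq]; exact hm)
  replace hL := hL.trans (.swap _ _ _)
  have hl' : l' ∈ L := hL.mem_iff.2 (by simp)
  obtain ⟨D, hqD, hD, hc, hu⟩ : ∃ D, (q, y) ∈ slots D ∧ (∀ w, IsEnd w D → IsEnd w l) ∧
      IsMinCover F m (l' :: D :: K) col ∧ ∀ j, Unused L col j → Unused (l' :: D :: K) col j := by
    rcases hs with hs | hs
    · exact ⟨l, hs, fun _ h => h, h.perm hL, fun j hj => hj.perm hL⟩
    · refine ⟨l.reverse, mem_slots_reverse.2 hs, fun w => isEnd_reverse.1, ?_, fun j hj => ?_⟩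
      · exact (h.perm (hL.trans (.swap _ _ _))).reverse.perm (.swap _ _ _)
      · exact (hj.perm (hL.trans (.swap _ _ _))).reverse.perm (.swap _ _ _)
  obtain ⟨A, x, rfl⟩ : ∃ A x, l' = A ++ [x] := by
    obtain ⟨A, x, hA⟩ := (List.eq_nil_or_concat l').resolve_left (h.ne_nil_of_mem hl')
    exact ⟨A, x, by simpa using hA⟩
  obtain ⟨P, Q, rfl⟩ := mem_slots.1 hqD
  have hxq : (F i).Adj x q := ((hT _ hl').2 x (isEnd_concat x A) q).2 hq
  obtain ⟨col', hc', hu'⟩ := hc.toIsRainbowCover.attach (hu i hi) hxq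
  have h' := hc.of_cover hc' rfl
  obtain ⟨w, Q', hw⟩ := List.exists_cons_of_ne_nil (l := P ++ [q]) (by simp)
  have hwl : IsEnd w l := hD w (Or.inl ⟨Q' ++ y :: Q, by
    rw [← List.cons_append, ← hw]; simp⟩)
  have hwl' : IsEnd w (A ++ x :: (P ++ [q]).reverse) := by
    rw [hw]
    exact Or.inr ⟨A ++ x :: Q'.reverse, by simp⟩
  have hold : ∀ j, j ≠ i → Unused L col j →
      Unused ((A ++ x :: (P ++ [q]).reverse) :: (y :: Q) :: K) col' j :=
    fun j hji hj => hu' j (Or.inr ⟨hu j hj, hji⟩)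
  refine ⟨_, col', h', ⟨_, by simp, isEnd_cons y Q⟩, hu' _ (Or.inl rfl), hold, ?_⟩
  -- A colour unused before and after the exchange lets the covers be compared. The end `w`
  -- survives, so its neighbourhood `T` is also the new alternating set. A split cover is
  -- impossible: `w` and `x`, now on one path, would be adjacent although `x` is not in `T`.
  obtain ⟨j', hj'i, hj'⟩ := h.exists_unused_ne i
  have hwT := ((h.isAlternating_congr hm hi hj' hT) l hl).2 w hwl
  have key : IsAlternating (F j') ((A ++ x :: (P ++ [q]).reverse) :: (y :: Q) :: K) T := by
    rcases h'.alternating_or_split hm (hold j' hj'i hj') with ⟨T', hT'⟩ | ⟨-, hS⟩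
    · have : T' = T := Set.ext fun z => by
        rw [← hwT z, (hT' _ (List.mem_cons_self ..)).2 w hwl' z]
      exact this ▸ hT'
    · exfalso
      have hwx : x ≠ w := by
        have := h'.toIsRainbowCover.nodup_head
        rw [hw, List.nodup_append] at this
        have := (List.nodup_cons.1 this.2.1).1
        rintro rfl
        simp at this
      have := (hS _ (List.mem_cons_self ..) w hwl' x).2 ⟨by simp, hwx⟩
      exact (hT _ hl').1.2 x (isEnd_concat x A) ((hwT x).1 this)
  exact fun j hj => h'.isAlternating_congr hm (hold j' hj'i hj') hj key

/-- A vertex outside `T` that is not last on its path has its successor in `T`, so an exchange turns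
it into an end. -/
theorem adj_iff_of_alternating_unused (h : IsMinCover F m L col) (hm : 2 ≤ m)
    (hj : Unused L col j) (hT : IsAlternating (F j) L T) (hy : y ∉ T) (z : U) :
    (F j).Adj y z ↔ z ∈ T := by
  obtain ⟨l, hl, hyl⟩ := h.exists_mem y
  rcases exists_slot_left hyl with ⟨P, hP⟩ | ⟨q, hq⟩
  · exact (hT l hl).2 y (Or.inr ⟨P, hP⟩) z
  · have hqT : q ∈ T := by
      have := (hT l hl).1.1 y q hq
      tauto
    obtain ⟨i, hij, hi⟩ := h.exists_unused_ne j
    obtain ⟨L', col', h', ⟨l', hl', hy'⟩, -, hu, hT'⟩ := h.exists_alternating_end hm hi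
      (h.isAlternating_congr hm hj hi hT) hl (Or.inr hq) hqT
    exact (hT' j (hu j hij.symm hj) l' hl').2 y hy' z

/-- In an alternating minimum cover, `T` is the neighbourhood of every vertex outside `T`, in every
colour. -/
theorem adj_iff_of_alternating_all (h : IsMinCover F m L col) (hm : 2 ≤ m)
    (hj : Unused L col j) (hT : IsAlternating (F j) L T) (i : ι) (hy : y ∉ T) (z : U) :
    (F i).Adj y z ↔ z ∈ T := by
  by_cases hi : Unused L col i
  · exact h.adj_iff_of_alternating_unused hm hi (h.isAlternating_congr hm hj hi hT) hy z
  simp only [Unused, not_forall, not_not] at hi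
  obtain ⟨e, he, rfl⟩ := hi
  obtain ⟨l, hl, he⟩ := mem_coverEdges.1 he
  obtain ⟨q, q', hq, rfl⟩ := mem_pathEdges.1 he
  -- Exactly one endpoint of the edge lies in `T`, so the exchange can be made at this edge, and it
  -- releases the colour of the edge.
  have hqq := (hT l hl).1.1 q q' hq
  by_cases hqT : q ∈ T
  · obtain ⟨L', col', h', -, hu, -, hT'⟩ := h.exists_alternating_end hm hj hT hl (Or.inl hq) hqT
    exact h'.adj_iff_of_alternating_unused hm hu (hT' _ hu) hy z
  · obtain ⟨L', col', h', -, hu, -, hT'⟩ := h.exists_alternating_end hm hj hT hl (Or.inr hq)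
      (by tauto : q' ∈ T)
    rw [Sym2.eq_swap] at hu
    exact h'.adj_iff_of_alternating_unused hm hu (hT' _ hu) hy z

/-- Every vertex that is not the first one on its path becomes an end of another split cover with
the same vertex sets. -/
theorem exists_split_end (h : IsMinCover F m L col) (hm : 2 ≤ m) (hi : Unused L col i)
    (hS : IsSplit (F i) L) (hl : l ∈ L) (hs : (q, y) ∈ slots l) :
    ∃ L' col', IsMinCover F m L' col' ∧ (∃ l' ∈ L', IsEnd y l' ∧ ∀ t, t ∈ l' ↔ t ∈ l) ∧
      (∀ l₀ ∈ L, ∃ l' ∈ L', ∀ t, t ∈ l' ↔ t ∈ l₀) ∧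
      Unused L' col' (col s(q, y)) ∧ (∀ j, j ≠ i → Unused L col j → Unused L' col' j) ∧
      ∀ j, Unused L' col' j → IsSplit (F j) L' := by
  obtain ⟨K, hL⟩ := exists_perm_cons hl
  obtain ⟨P, Q, rfl⟩ := mem_slots.1 hs
  have hc := h.perm hL
  obtain ⟨R, x, hR⟩ : ∃ R x, y :: Q = R ++ [x] := by
    obtain ⟨A, x, hA⟩ := (List.eq_nil_or_concat (y :: Q)).resolve_left (by simp)
    exact ⟨A, x, by simpa using hA⟩
  have hnd := hc.toIsRainbowCover.nodup_head
  have hqx : q ≠ x := by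
    rw [List.nodup_append] at hnd
    have := (List.nodup_cons.1 hnd.2.1).1
    rintro rfl
    simp [hR] at this
  -- The last vertex sees all of its path, so rotation is possible at every slot.
  have hxq : (F i).Adj x q :=
    (hS _ hl x (Or.inr ⟨P ++ q :: R, by simp [hR]⟩) q).2 ⟨by simp, hqx⟩
  obtain ⟨col', hc', hu'⟩ := hc.toIsRainbowCover.rotate ⟨R, hR⟩ (hi.perm hL) hxq
  have h' := hc.of_cover hc' rfl
  have hmem : ∀ t, t ∈ P ++ q :: (y :: Q).reverse ↔ t ∈ P ++ q :: y :: Q := by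
    intro t
    simp only [List.mem_append, List.mem_cons, List.mem_reverse]
  obtain ⟨w, P', hw⟩ := List.exists_cons_of_ne_nil (l := P ++ [q]) (by simp)
  have e1 : P ++ q :: y :: Q = w :: (P' ++ y :: Q) := by
    rw [← List.cons_append, ← hw]; simp
  have e2 : P ++ q :: (y :: Q).reverse = w :: (P' ++ (y :: Q).reverse) := by
    rw [← List.cons_append, ← hw]; simp
  have hyend : IsEnd y (P ++ q :: (y :: Q).reverse) := Or.inr ⟨P ++ q :: Q.reverse, by simp⟩
  have hwl : IsEnd w (P ++ q :: y :: Q) := Or.inl ⟨_, e1⟩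
  have hwl' : IsEnd w (P ++ q :: (y :: Q).reverse) := Or.inl ⟨_, e2⟩
  have hwy : y ≠ w := by
    rw [e1] at hnd
    have := (List.nodup_cons.1 hnd).1
    rintro rfl
    simp at this
  have hold : ∀ j, j ≠ i → Unused L col j →
      Unused ((P ++ q :: (y :: Q).reverse) :: K) col' j :=
    fun j hji hj => hu' j (Or.inr ⟨hj.perm hL, hji⟩)
  refine ⟨_, col', h', ⟨_, List.mem_cons_self .., hyend, hmem⟩, ?_, hu' _ (Or.inl rfl), hold, ?_⟩
  · intro l₀ hl₀
    rcases List.mem_cons.1 (hL.mem_iff.1 hl₀) with rfl | hl₀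
    · exact ⟨_, List.mem_cons_self .., hmem⟩
    · exact ⟨l₀, List.mem_cons_of_mem _ hl₀, fun t => Iff.rfl⟩
  -- The first vertex `w` stays an end and is adjacent to the new end `y`. In an alternating cover
  -- ends are never adjacent, so the new cover is split.
  obtain ⟨j', hj'i, hj'⟩ := h.exists_unused_ne i
  have hwy' : (F j').Adj w y := ((h.isSplit_congr hm hi hj' hS) _ hl w hwl y).2 ⟨by simp, hwy⟩
  rcases h'.alternating_or_split hm (hold j' hj'i hj') with ⟨T', hT'⟩ | ⟨-, hS'⟩
  · exfalso
    have := hT' _ (List.mem_cons_self ..)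
    exact this.1.2 y hyend ((this.2 w hwl' y).1 hwy')
  · exact fun j hj => h'.isSplit_congr hm (hold j' hj'i hj') hj hS'

theorem adj_iff_of_split_unused (h : IsMinCover F m L col) (hm : 2 ≤ m) (hj : Unused L col j)
    (hS : IsSplit (F j) L) (hl : l ∈ L) (hy : y ∈ l) (z : U) :
    (F j).Adj y z ↔ z ∈ l ∧ z ≠ y := by
  rcases exists_slot_right hy with ⟨Q, hQ⟩ | ⟨q, hq⟩
  · exact hS l hl y (Or.inl ⟨Q, hQ⟩) z
  · obtain ⟨i, hij, hi⟩ := h.exists_unused_ne j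
    obtain ⟨L', col', h', ⟨l', hl', hy', hmem⟩, -, -, hu, hS'⟩ := h.exists_split_end hm hi
      (h.isSplit_congr hm hj hi hS) hl hq
    rw [hS' j (hu j hij.symm hj) l' hl' y hy' z, hmem]

/-- In a split minimum cover, the path vertex sets are cliques without edges between them, in every
colour. -/
theorem adj_iff_of_split_all (h : IsMinCover F m L col) (hm : 2 ≤ m) (hj : Unused L col j)
    (hS : IsSplit (F j) L) (i : ι) (hl : l ∈ L) (hy : y ∈ l) (z : U) :
    (F i).Adj y z ↔ z ∈ l ∧ z ≠ y := by
  by_cases hi : Unused L col i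
  · exact h.adj_iff_of_split_unused hm hi (h.isSplit_congr hm hj hi hS) hl hy z
  simp only [Unused, not_forall, not_not] at hi
  obtain ⟨e, he, rfl⟩ := hi
  obtain ⟨l₀, hl₀, he⟩ := mem_coverEdges.1 he
  obtain ⟨q, q', hq, rfl⟩ := mem_pathEdges.1 he
  obtain ⟨L', col', h', -, hmem, hu, -, hS'⟩ := h.exists_split_end hm hj hS hl₀ hq
  obtain ⟨l', hl', hmem'⟩ := hmem l hl
  rw [h'.adj_iff_of_split_unused hm hu (hS' _ hu) hl' ((hmem' y).2 hy) z, hmem']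

end IsMinCover

/-- Rainbow path covers in a collection of graphs with an Ore-type degree condition: there are
fewer than `m` paths, apart from two extremal configurations. -/
theorem exists_rainbowCover_or_extremal (F : ι → SimpleGraph U) [∀ i, DecidableRel (F i).Adj]
    (m : ℕ) (hm : 2 ≤ m) (hι : Fintype.card U + m ≤ Fintype.card ι)
    (hF : ∀ i x y, x ≠ y → ¬ (F i).Adj x y →
      Fintype.card U ≤ (F i).degree x + (F i).degree y + m) :
    (∃ L col, IsRainbowCover F L col ∧ L.length < m) ∨
    (m = 2 ∧ ∃ X Y : Finset U, Disjoint X Y ∧ X ∪ Y = Finset.univ ∧ X.Nonempty ∧ Y.Nonempty ∧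
      ∀ i, (∀ x ∈ X, ∀ z, (F i).Adj x z ↔ z ∈ X ∧ z ≠ x) ∧
        ∀ y ∈ Y, ∀ z, (F i).Adj y z ↔ z ∈ Y ∧ z ≠ y) ∨
    ∃ T : Finset U, 2 * T.card + m = Fintype.card U ∧
      ∀ i, ∀ y ∉ T, ∀ z, (F i).Adj y z ↔ z ∈ T := by
  classical
  -- The cover by single vertices has no edges and needs no colours.
  have hex : ∃ M, ∃ L col, IsRainbowCover F L col ∧ L.length = M := by
    have : Nonempty ι := Fintype.card_pos_iff.1 (by omega)
    obtain ⟨i⟩ := this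
    have hflat : ((Finset.univ : Finset U).toList.map fun x => [x]).flatten =
        (Finset.univ : Finset U).toList := by
      rw [← List.flatMap_def]; simp
    have hE : coverEdges ((Finset.univ : Finset U).toList.map fun x => [x]) = 0 := by
      rw [Multiset.eq_zero_iff_forall_notMem]
      intro e he
      obtain ⟨l, hl, he⟩ := mem_coverEdges.1 he
      obtain ⟨x, -, rfl⟩ := List.mem_map.1 hl
      simp at he
    refine ⟨_, (Finset.univ : Finset U).toList.map fun x => [x], fun _ => i,
      ⟨?_, ?_, ?_, ?_, ?_⟩, rfl⟩
    · rw [hflat]; exact Finset.nodup_toList _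
    · rw [hflat]; simp
    · simp
    · rw [hE]; intro a ha; simp at ha
    · rw [hE]; intro a ha; simp at ha
  obtain ⟨L, col, hL, hLM⟩ := Nat.find_spec hex
  have hmin : ∀ L' col', IsRainbowCover F L' col' → Nat.find hex ≤ L'.length :=
    fun L' col' h' => Nat.find_min' hex ⟨L', col', h', rfl⟩
  by_cases hlt : L.length < m
  · exact Or.inl ⟨L, col, hL, hlt⟩
  right
  set M := Nat.find hex
  have hM : m ≤ M := by omega
  have h : IsMinCover F M L col := ⟨hL, hLM, hmin, by omega, fun i x y hxy hn =>
    (hF i x y hxy hn).trans (by omega)⟩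
  obtain ⟨l₁, l₂, K, rfl⟩ : ∃ l₁ l₂ K, L = l₁ :: l₂ :: K := by
    match L, hlt with
    | [], hlt => simp at hlt; omega
    | [_], hlt => simp at hlt; omega
    | a :: b :: K, _ => exact ⟨a, b, K, rfl⟩
  obtain ⟨A, x, rfl⟩ : ∃ A x, l₁ = A ++ [x] := by
    obtain ⟨A, x, hA⟩ := (List.eq_nil_or_concat l₁).resolve_left (h.ne_nil_of_mem (by simp))
    exact ⟨A, x, by simpa using hA⟩
  obtain ⟨y, B, rfl⟩ := List.exists_cons_of_ne_nil (h.ne_nil_of_mem (l := l₂) (by simp))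
  -- This degree sum is at most |U| - M by the crossing count and at least |U| - m by assumption;
  -- with m ≤ M this gives M = m.
  obtain ⟨j, hj, hdeg⟩ := h.cross.2
  have hxy : x ≠ y := by
    have := h.nodup
    simp only [List.flatten_cons, List.append_assoc, List.nodup_append] at this
    exact fun hxy => this.2.1.2.2 x (by simp) y (by simp) hxy
  have hdeg' := hF j x y hxy (h.not_adj_last_head hj)
  have hMm : M = m := by omega
  rcases h.alternating_or_split (by omega) hj with ⟨T, hT⟩ | ⟨h2, hS⟩
  · right
    have hT' := fun i y hy z => h.adj_iff_of_alternating_all (y := y) (by omega) hj hT i hy z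
    refine ⟨Finset.univ.filter (· ∈ T), ?_, fun i y hy z => ?_⟩
    -- Every end has degree |T|, so the tight degree sum reads 2|T| + m = |U|.
    · have hn : ∀ w l, l ∈ (A ++ [x]) :: (y :: B) :: K → IsEnd w l →
          (F j).degree w = (Finset.univ.filter (· ∈ T)).card := by
        intro w l hl hw
        rw [← SimpleGraph.card_neighborFinset_eq_degree]
        congr 1
        ext z
        simpa using (hT l hl).2 w hw z
      have h1 := hn x _ (by simp) (isEnd_concat x A)
      have h2 := hn y (y :: B) (by simp) (isEnd_cons y B)
      omega
    · simpa using hT' i y (by simpa using hy) z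
  · left
    refine ⟨by omega, ?_⟩
    obtain rfl : K = [] := by
      have := h.length_eq
      simp at this
      exact List.length_eq_zero_iff.1 (by omega)
    refine ⟨(A ++ [x]).toFinset, (y :: B).toFinset, ?_, ?_, ⟨x, by simp⟩, ⟨y, by simp⟩,
      fun i => ⟨fun a ha z => ?_, fun a ha z => ?_⟩⟩
    · rw [Finset.disjoint_left]
      intro a ha hb
      have := h.nodup
      rw [List.flatten_cons, List.nodup_append] at this
      exact this.2.2 a (List.mem_toFinset.1 ha) a (by simpa using hb) rfl
    · ext z
      have := h.cover z
      simp at this ⊢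
      tauto
    · rw [h.adj_iff_of_split_all (by omega) hj hS i (l := A ++ [x]) (by simp)
        (List.mem_toFinset.1 ha) z, List.mem_toFinset]
    · rw [h.adj_iff_of_split_all (by omega) hj hS i (l := y :: B) (by simp)
        (List.mem_toFinset.1 ha) z, List.mem_toFinset]

end RainbowOre

/-! ### Hamiltonian paths through the forest and the repair of bad edges. -/

namespace RainbowOre

variable {V ι : Type*}

/-- The list `p` is a Hamiltonian path from `u` to `v` through all edges of `H`, and `col` is an
injective colouring of its edges which extends the colouring `c` of `H`. -/
structure IsForestPath (H : SimpleGraph V) (c : Sym2 V → ι) (u v : V) (p : List V)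
    (col : Sym2 V → ι) : Prop where
  nodup : p.Nodup
  cover : ∀ x, x ∈ p
  head : p.head? = some u
  last : p.getLast? = some v
  sub : ∀ e ∈ H.edgeSet, e ∈ pathEdges p
  inj : Set.InjOn col {e | e ∈ pathEdges p}
  eqOn : Set.EqOn col c H.edgeSet

open scoped Classical in
/-- The edges of a path whose colour class does not contain them. -/
noncomputable def badEdges (G : ι → SimpleGraph V) (p : List V) (col : Sym2 V → ι) :
    Multiset (Sym2 V) :=
  (pathEdges p).filter fun e => e ∉ (G (col e)).edgeSet

/-- The measure of progress for both repairs: the bad edge `e` disappears, kept edges keep their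
colours, and all new edges in `S` are good. -/
theorem card_badEdges_lt {G : ι → SimpleGraph V} {p p' : List V} {col col' : Sym2 V → ι}
    {e : Sym2 V} {M S : Multiset (Sym2 V)} (hp : e ::ₘ M ≤ pathEdges p)
    (he : e ∉ (G (col e)).edgeSet) (hp' : pathEdges p' = S + M)
    (hS : ∀ f ∈ S, f ∈ (G (col' f)).edgeSet) (hM : ∀ f ∈ M, col' f = col f) :
    (badEdges G p' col').card < (badEdges G p col).card := by
  classical
  have h1 := Multiset.card_le_card (Multiset.filter_le_filter
    (fun e => e ∉ (G (col e)).edgeSet) hp)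
  rw [Multiset.filter_cons_of_pos (p := fun e => e ∉ (G (col e)).edgeSet) M he, Multiset.card_cons] at h1
  have h2 : (badEdges G p' col') = M.filter fun e => e ∉ (G (col e)).edgeSet := by
    unfold badEdges
    rw [hp', Multiset.filter_add, Multiset.filter_eq_nil.2 (fun f hf => not_not.2 (hS f hf)),
      zero_add]
    exact Multiset.filter_congr fun f hf => by rw [hM f hf]
  rw [h2]
  unfold badEdges
  convert Nat.lt_of_succ_le h1

variable {G : ι → SimpleGraph V} {H : SimpleGraph V} {c : Sym2 V → ι} {u v : V} {p p' : List V}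
  {col : Sym2 V → ι} {x y q q' : V}

theorem getLast?_append_cons (A B : List V) (b : V) :
    (A ++ b :: B).getLast? = (b :: B).getLast? := by
  rw [List.getLast?_append, List.getLast?_cons, Option.some_or]

/-- The two ways to reconnect a path after removing two of its edges while keeping its ends. -/
theorem exists_reconnect (hxy : (x, y) ∈ slots p) (hq : (q, q') ∈ slots p)
    (hne : (q, q') ≠ (x, y)) :
    ∃ p' M, p.Perm p' ∧ p'.head? = p.head? ∧ p'.getLast? = p.getLast? ∧
      pathEdges p = s(x, y) ::ₘ s(q, q') ::ₘ M ∧ pathEdges p' = s(x, q) ::ₘ s(y, q') ::ₘ M := by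
  obtain ⟨P, Q, rfl⟩ := mem_slots.1 hxy
  rw [slots_append_cons_cons, List.mem_append, List.mem_cons] at hq
  have hE := pathEdges_append_cons_cons P Q x y
  rcases hq with hq | hq | hq
  · obtain ⟨R, S, hRS⟩ := mem_slots.1 hq
    obtain ⟨S', b, hS'⟩ := (List.eq_nil_or_concat (q' :: S)).resolve_left (by simp)
    rw [List.concat_eq_append] at hS'
    have hb : P ++ [x] = (R ++ q :: S') ++ [b] := by rw [hRS, hS']; simp
    obtain ⟨-, hb⟩ := List.append_inj' hb rfl
    obtain rfl : x = b := by simpa using hb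
    have e1 : P ++ x :: y :: Q = R ++ q :: ((q' :: S) ++ y :: Q) := by
      have : P ++ x :: y :: Q = (P ++ [x]) ++ y :: Q := by simp
      rw [this, hRS]; simp
    have e2 : R ++ q :: ((q' :: S).reverse ++ y :: Q) = (R ++ q :: S.reverse) ++ q' :: y :: Q := by
      simp
    have e3 : (R ++ q :: S.reverse) ++ [q'] = R ++ q :: x :: S'.reverse := by
      have : (q' :: S).reverse = x :: S'.reverse := by rw [hS']; simp
      rw [← this]; simp
    have e4 : pathEdges (x :: S'.reverse) = pathEdges (q' :: S) := by
      rw [← pathEdges_reverse (q' :: S), hS']; simp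
    refine ⟨R ++ q :: ((q' :: S).reverse ++ y :: Q),
      pathEdges (R ++ [q]) + pathEdges (q' :: S) + pathEdges (y :: Q), ?_, ?_, ?_, ?_, ?_⟩
    · rw [e1]
      exact (((List.reverse_perm _).symm.append_right _).cons q).append_left R
    · rw [e1]; simp
    · rw [getLast?_append_cons P, getLast?_append_cons R, List.getLast?_cons_cons,
        ← List.cons_append, getLast?_append_cons (q :: _)]
    · rw [hE, hRS, pathEdges_append_cons_cons, Multiset.cons_add]
    · rw [e2, pathEdges_append_cons_cons, e3, pathEdges_append_cons_cons, e4, Multiset.cons_add,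
        Multiset.cons_swap, Sym2.eq_swap (a := q), Sym2.eq_swap (a := q')]
  · exact absurd hq hne
  · obtain ⟨R, S, hRS⟩ := mem_slots.1 hq
    obtain ⟨b, R', hR'⟩ := List.exists_cons_of_ne_nil (l := R ++ [q]) (by simp)
    have hb : y :: Q = b :: (R' ++ q' :: S) := by rw [hRS, ← List.cons_append, ← hR']; simp
    obtain ⟨rfl, -⟩ := List.cons.inj hb
    have e1 : P ++ x :: y :: Q = P ++ x :: ((R ++ [q]) ++ q' :: S) := by rw [hRS]; simp
    have e2 : P ++ x :: ((R ++ [q]).reverse ++ q' :: S) =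
        (P ++ x :: R'.reverse) ++ y :: q' :: S := by rw [hR']; simp
    have e3 : (P ++ x :: R'.reverse) ++ [y] = P ++ x :: q :: R.reverse := by
      have : (R ++ [q]).reverse = R'.reverse ++ [y] := by rw [hR']; simp
      rw [List.append_assoc, List.cons_append, ← this]; simp
    have e4 : pathEdges (q :: R.reverse) = pathEdges (R ++ [q]) := by
      rw [← pathEdges_reverse (R ++ [q])]; simp
    refine ⟨P ++ x :: ((R ++ [q]).reverse ++ q' :: S),
      pathEdges (P ++ [x]) + pathEdges (R ++ [q]) + pathEdges (q' :: S), ?_, ?_, ?_, ?_, ?_⟩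
    · rw [e1]
      exact (((List.reverse_perm _).symm.append_right _).cons x).append_left P
    · rw [e1]; simp
    · rw [e1, getLast?_append_cons P, getLast?_append_cons P, ← List.cons_append,
        ← List.cons_append, getLast?_append_cons (x :: _), getLast?_append_cons (x :: _)]
    · rw [hE, hRS, pathEdges_append_cons_cons, Multiset.add_cons, add_assoc]
    · rw [e2, pathEdges_append_cons_cons, e3, pathEdges_append_cons_cons, e4, Multiset.cons_add,
        Multiset.cons_swap]

namespace IsForestPath

theorem length_eq [Fintype V] (h : IsForestPath H c u v p col) : p.length = Fintype.card V := by
  classical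
  rw [← List.toFinset_card_of_nodup h.nodup, ← Finset.card_univ]
  congr 1
  ext x
  simp [h.cover x]

theorem ne_nil (h : IsForestPath H c u v p col) : p ≠ [] := by
  rintro rfl
  simpa using h.head

variable [DecidableEq V]

theorem exists_recolor (h : IsForestPath H c u v p col)
    (hHG : ∀ e ∈ H.edgeSet, e ∈ (G (c e)).edgeSet) {e : Sym2 V} (he : e ∈ pathEdges p)
    (hbad : e ∉ (G (col e)).edgeSet) {j : ι} (hj : ∀ e ∈ pathEdges p, col e ≠ j)
    (hej : e ∈ (G j).edgeSet) :
    ∃ col', IsForestPath H c u v p col' ∧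
      (badEdges G p col').card < (badEdges G p col).card ∧
      ∀ e ∈ badEdges G p col', e ∈ badEdges G p col := by
  obtain ⟨M, hM⟩ := Multiset.exists_cons_of_mem he
  have heM : e ∉ M := by
    have := nodup_pathEdges h.nodup
    rw [hM, Multiset.nodup_cons] at this
    exact this.1
  -- Edges of `H` carry their colour from `c` and are good there, so a bad edge is outside `H` and
  -- may be changed.
  have heH : e ∉ H.edgeSet := fun h' => hbad (by rw [h.eqOn h']; exact hHG e h')
  have hcol : ∀ f, f ≠ e → Function.update col e j f = col f := fun f hf =>
    Function.update_of_ne hf _ _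
  refine ⟨Function.update col e j, ⟨h.nodup, h.cover, h.head, h.last, h.sub, ?_, ?_⟩, ?_, ?_⟩
  · intro a ha b hb hab
    by_cases hae : a = e <;> by_cases hbe : b = e
    · rw [hae, hbe]
    · rw [hae, Function.update_self, hcol b hbe] at hab
      exact absurd hab.symm (hj b hb)
    · rw [hbe, Function.update_self, hcol a hae] at hab
      exact absurd hab (hj a ha)
    · rw [hcol a hae, hcol b hbe] at hab
      exact h.inj ha hb hab
  · intro f hf
    rw [hcol f (by rintro rfl; exact heH hf)]
    exact h.eqOn hf
  · refine card_badEdges_lt (e := e) (M := M) (S := {e}) (by rw [hM]) hbad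
      (by rw [hM]; rfl) ?_ ?_
    · intro f hf
      rw [Multiset.mem_singleton] at hf
      subst hf
      simpa using hej
    · intro f hf
      exact hcol f (by rintro rfl; exact heM hf)
  · intro f hf
    simp only [badEdges, Multiset.mem_filter] at hf ⊢
    by_cases hfe : f = e
    · subst hfe
      simp [hej] at hf
    · rwa [hcol f hfe] at hf

/-- Removing the bad edge releases its colour, so that colour and one missing on the path can serve
as `a` and `b` for the two new edges. The edge `s(q, q')` is sacrificed, hence must not belong to
`H`. -/
theorem exists_cross (h : IsForestPath H c u v p col)
    (hHG : ∀ e ∈ H.edgeSet, e ∈ (G (c e)).edgeSet) (hxy : (x, y) ∈ slots p)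
    (hbad : s(x, y) ∉ (G (col s(x, y))).edgeSet) (hq : (q, q') ∈ slots p)
    (hne : (q, q') ≠ (x, y)) (hqH : s(q, q') ∉ H.edgeSet) {a b : ι} (hab : a ≠ b)
    (ha : ∀ e ∈ pathEdges p, e ≠ s(x, y) → col e ≠ a)
    (hb : ∀ e ∈ pathEdges p, e ≠ s(x, y) → col e ≠ b)
    (hxq : (G a).Adj x q) (hyq : (G b).Adj y q') :
    ∃ p' col', IsForestPath H c u v p' col' ∧
      (badEdges G p' col').card < (badEdges G p col).card ∧
      ∀ e ∈ badEdges G p' col', e ∈ badEdges G p col := by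
  obtain ⟨p', M, hperm, hhead, hlast, hE, hE'⟩ := exists_reconnect hxy hq hne
  have hnd' : p'.Nodup := hperm.nodup_iff.1 h.nodup
  have hn := nodup_pathEdges h.nodup
  have hn' := nodup_pathEdges hnd'
  rw [hE, Multiset.nodup_cons, Multiset.nodup_cons, Multiset.mem_cons, not_or] at hn
  rw [hE', Multiset.nodup_cons, Multiset.nodup_cons, Multiset.mem_cons, not_or] at hn'
  have hxyH : s(x, y) ∉ H.edgeSet := fun h' => hbad (by rw [h.eqOn h']; exact hHG _ h')
  set col' := Function.update (Function.update col s(x, q) a) s(y, q') b with hcol'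
  have hM : ∀ e ∈ M, col' e = col e := by
    intro e he
    rw [hcol', Function.update_of_ne (by rintro rfl; exact hn'.2.1 he),
      Function.update_of_ne (by rintro rfl; exact hn'.1.2 he)]
  have hc1 : col' s(x, q) = a := by
    rw [hcol', Function.update_of_ne hn'.1.1, Function.update_self]
  have hc2 : col' s(y, q') = b := by rw [hcol', Function.update_self]
  have hMp : ∀ e ∈ M, e ∈ pathEdges p ∧ e ≠ s(x, y) := fun e he =>
    ⟨by simp [hE, he], by rintro rfl; exact hn.1.2 he⟩
  have hHM : ∀ e ∈ H.edgeSet, e ∈ M := by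
    intro e he
    have := h.sub e he
    rw [hE, Multiset.mem_cons, Multiset.mem_cons] at this
    rcases this with rfl | rfl | this
    · exact absurd he hxyH
    · exact absurd he hqH
    · exact this
  refine ⟨p', col', ⟨hnd', fun x => hperm.mem_iff.1 (h.cover x), hhead.trans h.head,
    hlast.trans h.last, fun e he => by simp [hE', hHM e he], ?_, ?_⟩, ?_, ?_⟩
  · rw [hE']
    intro f hf g hg hfg
    simp only [Multiset.mem_cons, Set.mem_ofPred_eq] at hf hg
    have key : ∀ e ∈ M, col' e ≠ a ∧ col' e ≠ b := fun e he => by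
      rw [hM e he]
      exact ⟨ha e (hMp e he).1 (hMp e he).2, hb e (hMp e he).1 (hMp e he).2⟩
    rcases hf with rfl | rfl | hf <;> rcases hg with rfl | rfl | hg
    · rfl
    · rw [hc1, hc2] at hfg; exact absurd hfg hab
    · rw [hc1] at hfg; exact absurd hfg.symm (key g hg).1
    · rw [hc1, hc2] at hfg; exact absurd hfg.symm hab
    · rfl
    · rw [hc2] at hfg; exact absurd hfg.symm (key g hg).2
    · rw [hc1] at hfg; exact absurd hfg (key f hf).1
    · rw [hc2] at hfg; exact absurd hfg (key f hf).2
    · rw [hM f hf, hM g hg] at hfg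
      exact h.inj (hMp f hf).1 (hMp g hg).1 hfg
  · intro e he
    rw [hM e (hHM e he)]
    exact h.eqOn he
  · refine card_badEdges_lt (e := s(x, y)) (M := M) (S := {s(x, q), s(y, q')}) ?_ hbad ?_ ?_ hM
    · rw [hE]
      exact Multiset.cons_le_cons _ (Multiset.le_cons_self _ _)
    · rw [hE']
      simp
    · intro f hf
      simp only [Multiset.insert_eq_cons, Multiset.mem_cons, Multiset.mem_singleton] at hf
      rcases hf with rfl | rfl
      · rw [hc1]; exact hxq
      · rw [hc2]; exact hyq
  · intro f hf
    simp only [badEdges, Multiset.mem_filter, hE', Multiset.mem_cons] at hf ⊢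
    obtain ⟨rfl | rfl | hfM, hf⟩ := hf
    · rw [hc1] at hf; exact absurd hxq hf
    · rw [hc2] at hf; exact absurd hyq hf
    · rw [hM f hfM] at hf
      exact ⟨(hMp f hfM).1, hf⟩

variable [Fintype V]

theorem exists_unused [Fintype ι] (h : IsForestPath H c u v p col) (hι : Fintype.card V ≤ Fintype.card ι) :
    ∃ j, ∀ e ∈ pathEdges p, col e ≠ j := by
  classical
  by_contra! hcon
  have h1 : Finset.univ ⊆ (pathEdges p).toFinset.image col := by
    intro j _
    obtain ⟨e, he, rfl⟩ := hcon j
    exact Finset.mem_image_of_mem _ (by simpa using he)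
  have h2 := (Finset.card_le_card h1).trans
    (Finset.card_image_le.trans (Multiset.toFinset_card_le _))
  have h3 := card_pathEdges h.ne_nil
  rw [h.length_eq] at h3
  rw [Finset.card_univ] at h2
  omega

/-- Every vertex except the last one, `v`, is the first entry of a slot; the extra term accounts for
`v`. -/
theorem degree_le_card_slots_left (h : IsForestPath H c u v p col) (F : SimpleGraph V)
    [DecidableRel F.Adj] (x : V) :
    F.degree x ≤ ∑ s ∈ (slots p).toFinset, (if F.Adj x s.1 then 1 else 0) +
      if F.Adj x v then 1 else 0 := by
  rw [← Finset.card_filter, ← SimpleGraph.card_neighborFinset_eq_degree]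
  have hv : (if F.Adj x v then 1 else 0) = (({v} : Finset V).filter (F.Adj x)).card := by
    by_cases hxv : F.Adj x v <;> simp [hxv, Finset.filter_singleton]
  rw [hv]
  refine (Finset.card_le_card (t := ((slots p).toFinset.filter fun s => F.Adj x s.1).image Prod.fst
    ∪ ({v} : Finset V).filter (F.Adj x)) ?_).trans ((Finset.card_union_le _ _).trans
      (Nat.add_le_add_right Finset.card_image_le _))
  intro z hz
  rw [SimpleGraph.mem_neighborFinset] at hz
  rcases exists_slot_left (h.cover z) with ⟨P, hP⟩ | ⟨q', hq⟩
  · have : z = v := by simpa [hP] using h.last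
    subst this
    exact Finset.mem_union_right _ (by simpa using hz)
  · refine Finset.mem_union_left _ (Finset.mem_image.2 ⟨(z, q'), ?_, rfl⟩)
    simp [hq, hz]

theorem degree_le_card_slots_right (h : IsForestPath H c u v p col) (F : SimpleGraph V)
    [DecidableRel F.Adj] (y : V) :
    F.degree y ≤ ∑ s ∈ (slots p).toFinset, (if F.Adj y s.2 then 1 else 0) +
      if F.Adj y u then 1 else 0 := by
  rw [← Finset.card_filter, ← SimpleGraph.card_neighborFinset_eq_degree]
  have hv : (if F.Adj y u then 1 else 0) = (({u} : Finset V).filter (F.Adj y)).card := by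
    by_cases hxv : F.Adj y u <;> simp [hxv, Finset.filter_singleton]
  rw [hv]
  refine (Finset.card_le_card (t := ((slots p).toFinset.filter fun s => F.Adj y s.2).image Prod.snd
    ∪ ({u} : Finset V).filter (F.Adj y)) ?_).trans ((Finset.card_union_le _ _).trans
      (Nat.add_le_add_right Finset.card_image_le _))
  intro z hz
  rw [SimpleGraph.mem_neighborFinset] at hz
  rcases exists_slot_right (h.cover z) with ⟨Q, hQ⟩ | ⟨q, hq⟩
  · have : z = u := by simpa [hQ] using h.head
    subst this
    exact Finset.mem_union_right _ (by simpa using hz)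
  · refine Finset.mem_union_left _ (Finset.mem_image.2 ⟨(q, z), ?_, rfl⟩)
    simp [hq, hz]

/-- The total crossing capacity of the slots: none at `(x, y)`, four at the edges of `H` and two at
all others. -/
theorem sum_capacity_le [DecidableRel H.Adj] (h : IsForestPath H c u v p col)
    (hxy : (x, y) ∈ slots p) (hxyH : s(x, y) ∉ H.edgeSet) :
    ∑ s ∈ (slots p).toFinset, (if s = (x, y) then 0 else if H.Adj s.1 s.2 then 4 else 2) + 4 ≤
      2 * Fintype.card V + 2 * H.edgeFinset.card := by
  have h1 : ∑ s ∈ (slots p).toFinset, (if s = (x, y) then 0 else if H.Adj s.1 s.2 then 4 else 2) +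
      ∑ s ∈ (slots p).toFinset, (if s = (x, y) then 2 else 0) =
      ∑ s ∈ (slots p).toFinset, 2 + 2 * ∑ s ∈ (slots p).toFinset,
        (if H.Adj s.1 s.2 then 1 else 0) := by
    rw [Finset.mul_sum, ← Finset.sum_add_distrib, ← Finset.sum_add_distrib]
    refine Finset.sum_congr rfl fun s _ => ?_
    by_cases hs : s = (x, y)
    · subst hs
      have : ¬ H.Adj x y := hxyH
      simp [this]
    · by_cases hs' : H.Adj s.1 s.2 <;> simp [hs, hs']
  rw [Finset.sum_ite_eq' _ _ (fun _ => 2), if_pos (by simpa using hxy), ← Finset.card_filter,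
    Finset.sum_const, smul_eq_mul] at h1
  have h2 : ((slots p).toFinset.filter fun s => H.Adj s.1 s.2).card ≤ H.edgeFinset.card := by
    refine Finset.card_le_card_of_injOn (fun s => s(s.1, s.2)) ?_ ?_
    · intro s hs
      simpa using (Finset.mem_filter.1 hs).2
    · intro s hs t ht hst
      have hnd := nodup_pathEdges h.nodup
      rw [pathEdges, Multiset.coe_nodup] at hnd
      refine List.inj_on_of_nodup_map hnd ?_ ?_ hst
      · simpa using (Finset.mem_filter.1 hs).1
      · simpa using (Finset.mem_filter.1 ht).1
  have h3 : (slots p).toFinset.card + 1 ≤ Fintype.card V := by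
    have := List.toFinset_card_le (slots p)
    have h4 := length_slots h.ne_nil
    rw [h.length_eq] at h4
    omega
  omega

/-- A bad edge of the path that meets the forest can be removed. -/
theorem exists_improve [Fintype ι] [DecidableRel H.Adj] [∀ i, DecidableRel (G i).Adj]
    (h : IsForestPath H c u v p col) (hι : Fintype.card V ≤ Fintype.card ι)
    (hHG : ∀ e ∈ H.edgeSet, e ∈ (G (c e)).edgeSet)
    (hG : ∀ i x y, x ≠ y → ¬ (G i).Adj x y →
      Fintype.card V + H.edgeFinset.card ≤ (G i).degree x + (G i).degree y)
    (hxy : (x, y) ∈ slots p) (hbad : s(x, y) ∉ (G (col s(x, y))).edgeSet)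
    (hW : x ∈ forestVerts H u v ∨ y ∈ forestVerts H u v) :
    ∃ p' col', IsForestPath H c u v p' col' ∧
      (badEdges G p' col').card < (badEdges G p col).card ∧
      ∀ e ∈ badEdges G p' col', e ∈ badEdges G p col := by
  obtain ⟨j, hj⟩ := h.exists_unused hι
  have hxyE : s(x, y) ∈ pathEdges p := mem_pathEdges.2 ⟨x, y, hxy, rfl⟩
  by_cases hej : s(x, y) ∈ (G j).edgeSet
  · exact ⟨p, h.exists_recolor hHG hxyE hbad hj hej⟩
  by_contra hcon
  set i := col s(x, y) with hi
  have hij : i ≠ j := hj _ hxyE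
  have hne : x ≠ y := ne_of_mem_slots h.nodup hxy
  have hxyH : s(x, y) ∉ H.edgeSet := fun h' => hbad (by rw [hi, h.eqOn h']; exact hHG _ h')
  have hxyi : ¬ (G i).Adj x y := hbad
  have hxyj : ¬ (G j).Adj x y := hej
  have hci : ∀ e ∈ pathEdges p, e ≠ s(x, y) → col e ≠ i := fun e he hne hei =>
    hne (h.inj he hxyE hei)
  have hcj : ∀ e ∈ pathEdges p, e ≠ s(x, y) → col e ≠ j := fun e he _ => hj e he
  have hno : ∀ s ∈ (slots p).toFinset, s ≠ (x, y) → ¬ H.Adj s.1 s.2 →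
      ¬ ((G i).Adj x s.1 ∧ (G j).Adj y s.2) ∧ ¬ ((G j).Adj x s.1 ∧ (G i).Adj y s.2) := by
    rintro ⟨q, q'⟩ hs hsne hsH
    rw [List.mem_toFinset] at hs
    exact ⟨fun ⟨h1, h2⟩ => hcon (h.exists_cross hHG hxy hbad hs hsne hsH hij hci hcj h1 h2),
      fun ⟨h1, h2⟩ => hcon (h.exists_cross hHG hxy hbad hs hsne hsH hij.symm hcj hci h1 h2)⟩
  -- Adjacencies of `x` and `y` in both colours at one slot. Off `H` the exchange excludes the two
  -- mixed pairs, (`i` at `x`, `j` at `y`) and the reverse, so at most two of the four occur.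
  let val : V × V → ℕ := fun s => (if (G i).Adj x s.1 then 1 else 0) +
    (if (G i).Adj y s.2 then 1 else 0) + (if (G j).Adj x s.1 then 1 else 0) +
    (if (G j).Adj y s.2 then 1 else 0)
  let cap : V × V → ℕ := fun s => if s = (x, y) then 0 else if H.Adj s.1 s.2 then 4 else 2
  have hval : ∀ s ∈ (slots p).toFinset, val s ≤ cap s := by
    intro s hs
    by_cases hsxy : s = (x, y)
    · subst hsxy; simp [val, cap]
    · by_cases hsH : H.Adj s.1 s.2
      · simp only [val, cap, if_neg hsxy, if_pos hsH]
        split_ifs <;> omega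
      · have := hno s hs hsxy hsH
        simp only [val, cap, if_neg hsxy, if_neg hsH]
        split_ifs <;> first | omega | (exfalso; tauto)
  have hcap : ∑ s ∈ (slots p).toFinset, cap s + 4 ≤
      2 * Fintype.card V + 2 * H.edgeFinset.card := h.sum_capacity_le hxy hxyH
  have hsum : ∑ s ∈ (slots p).toFinset, val s =
      ∑ s ∈ (slots p).toFinset, (if (G i).Adj x s.1 then 1 else 0) +
      ∑ s ∈ (slots p).toFinset, (if (G i).Adj y s.2 then 1 else 0) +
      ∑ s ∈ (slots p).toFinset, (if (G j).Adj x s.1 then 1 else 0) +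
      ∑ s ∈ (slots p).toFinset, (if (G j).Adj y s.2 then 1 else 0) := by
    simp only [val, Finset.sum_add_distrib]
  have d1 := h.degree_le_card_slots_left (G i) x
  have d2 := h.degree_le_card_slots_right (G i) y
  have d3 := h.degree_le_card_slots_left (G j) x
  have d4 := h.degree_le_card_slots_right (G j) y
  have o1 := hG i x y hne hxyi
  have o2 := hG j x y hne hxyj
  have hle := Finset.sum_le_sum hval
  have b1 : (if (G i).Adj x v then 1 else 0) ≤ 1 := by split_ifs <;> simp
  have b2 : (if (G i).Adj y u then 1 else 0) ≤ 1 := by split_ifs <;> simp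
  have b3 : (if (G j).Adj x v then 1 else 0) ≤ 1 := by split_ifs <;> simp
  have b4 : (if (G j).Adj y u then 1 else 0) ≤ 1 := by split_ifs <;> simp
  -- The two Ore bounds require 2(n + k), with n the number of vertices and k the number of edges of
  -- `H`. The capacities and the four end terms sum to at most this number, so a single loss
  -- anywhere is contradictory.
  have hstrict : ∀ s ∈ (slots p).toFinset, val s < cap s → False := by
    intro s hs hlt
    have := Finset.sum_lt_sum hval ⟨s, hs, hlt⟩
    omega
  have hyx : ∀ i, (G i).Adj y x ↔ (G i).Adj x y := fun i => (G i).adj_comm y x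
  -- If `x` or `y` were `u` or `v`, an end term would ask for a loop or for the non-edge `xy` and
  -- vanish.
  have huv : x ≠ u ∧ x ≠ v ∧ y ≠ u ∧ y ≠ v := by
    refine ⟨?_, ?_, ?_, ?_⟩ <;> rintro rfl
    · rw [if_neg (by rwa [hyx])] at d2 b2; omega
    · rw [if_neg ((G i).irrefl)] at d1; omega
    · rw [if_neg ((G i).irrefl)] at d2; omega
    · rw [if_neg hxyi] at d1; omega
  have hslotH : ∀ s ∈ (slots p).toFinset, H.Adj s.1 s.2 → val s ≤ 2 → False := by
    intro s hs hsH hle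
    refine hstrict s hs ?_
    have : s ≠ (x, y) := by rintro rfl; exact hxyH hsH
    simp only [cap, if_neg this, if_pos hsH]
    omega
  have hend : ∀ a b, H.Adj a b → (a, b) ∈ (slots p).toFinset ∨ (b, a) ∈ (slots p).toFinset := by
    intro a b hab
    obtain ⟨q, q', hq, he⟩ := mem_pathEdges.1 (h.sub s(a, b) hab)
    rw [List.mem_toFinset, List.mem_toFinset]
    rcases Sym2.eq_iff.1 he with ⟨rfl, rfl⟩ | ⟨rfl, rfl⟩
    · exact Or.inl hq
    · exact Or.inr hq
  -- At an edge of `H` through `x` or `y`, two of the four adjacencies are loops or the non-edge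
  -- `xy`, so the capacity four is missed.
  have hsupp : ∀ a, (a = x ∨ a = y) → a ∉ H.support := by
    rintro a ha ⟨b, hab⟩
    rcases hend a b hab with hs | hs
    · refine hslotH _ hs hab ?_
      rcases ha with rfl | rfl
      · simp only [val, SimpleGraph.irrefl, if_false]
        split_ifs <;> omega
      · simp only [val, if_neg hxyi, if_neg hxyj]
        split_ifs <;> omega
    · refine hslotH _ hs hab.symm ?_
      rcases ha with rfl | rfl
      · simp only [val, hyx, if_neg hxyi, if_neg hxyj]
        split_ifs <;> omega
      · simp only [val, SimpleGraph.irrefl, if_false]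
        split_ifs <;> omega
  have h1 := hsupp x (Or.inl rfl)
  have h2 := hsupp y (Or.inr rfl)
  simp only [forestVerts, Set.mem_union, Set.mem_insert_iff, Set.mem_singleton_iff] at hW
  tauto

/-- If all bad edges of the path meet the forest, then there is a rainbow path. -/
theorem exists_rainbow [Fintype ι] [DecidableRel H.Adj] [∀ i, DecidableRel (G i).Adj]
    (h : IsForestPath H c u v p col) (hι : Fintype.card V ≤ Fintype.card ι)
    (hHG : ∀ e ∈ H.edgeSet, e ∈ (G (c e)).edgeSet)
    (hG : ∀ i x y, x ≠ y → ¬ (G i).Adj x y →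
      Fintype.card V + H.edgeFinset.card ≤ (G i).degree x + (G i).degree y)
    (hW : ∀ e ∈ badEdges G p col, ∃ w ∈ e, w ∈ forestVerts H u v) :
    ∃ p' col', IsForestPath H c u v p' col' ∧ ∀ e ∈ pathEdges p', e ∈ (G (col' e)).edgeSet := by
  induction hn : (badEdges G p col).card using Nat.strong_induction_on generalizing p col with
  | _ n ih =>
    by_cases hbad : ∀ e ∈ pathEdges p, e ∈ (G (col e)).edgeSet
    · exact ⟨p, col, h, hbad⟩
    push Not at hbad
    obtain ⟨e, he, hbad⟩ := hbad
    obtain ⟨w, hwe, hw⟩ := hW e (by simp [badEdges, he, hbad])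
    obtain ⟨x, y, hxy, rfl⟩ := mem_pathEdges.1 he
    obtain ⟨p', col', h', hlt, hsub⟩ := h.exists_improve hι hHG hG hxy hbad (by
      rcases Sym2.mem_iff.1 hwe with rfl | rfl
      · exact Or.inl hw
      · exact Or.inr hw)
    -- No new bad edges arise, so all bad edges still meet the forest.
    exact ih _ (hn ▸ hlt) h' (fun e he => hW e (hsub e he)) rfl

end IsForestPath

end RainbowOre

/-! ### Gluing lists of paths, extending colourings, and linear forests as lists. -/

namespace RainbowOre

section Combine

variable {α : Type*}

/-- The entries of `M` between `a` and `b` leave `M.length + 1` gaps, and each receives at most one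
entry of `S`. With `P` marking forest paths, no two cover paths become neighbours. -/
theorem exists_interleave {P : α → Prop} {S M : List α} (h : S.length ≤ M.length + 1)
    (hM : ∀ x ∈ M, P x) {a b : α} (ha : P a) (hb : P b) :
    ∃ K : List α, K.Perm (S ++ M) ∧ ∀ x y, (x, y) ∈ slots (a :: (K ++ [b])) → P x ∨ P y := by
  induction S generalizing M a with
  | nil =>
    refine ⟨M, by simp, fun x y hxy => Or.inl ?_⟩
    have := (mem_of_mem_slots hxy).1
    simp only [List.mem_cons, List.mem_append, List.not_mem_nil, or_false] at this
    rcases this with rfl | h | rfl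
    · exact ha
    · exact hM x h
    · exact hb
  | cons s S ih =>
    cases M with
    | nil =>
      obtain rfl : S = [] := List.length_eq_zero_iff.1 (by simpa using h)
      refine ⟨[s], by simp, ?_⟩
      intro x y hxy
      simp only [List.cons_append, List.nil_append, slots_cons_cons, slots_singleton,
        List.mem_cons, Prod.mk.injEq, List.not_mem_nil, or_false] at hxy
      rcases hxy with ⟨rfl, rfl⟩ | ⟨rfl, rfl⟩
      · exact Or.inl ha
      · exact Or.inr hb
    | cons m M =>
      have hm : P m := hM m (by simp)
      obtain ⟨K, hK, hs⟩ := ih (M := M) (a := m) (by simpa using h)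
        (fun x hx => hM x (by simp [hx])) hm
      refine ⟨s :: m :: K, ?_, ?_⟩
      · have : (s :: S ++ m :: M).Perm (s :: m :: (S ++ M)) := by
          simp
        exact ((hK.cons m).cons s).trans this.symm
      · intro x y hxy
        simp only [List.cons_append, slots_cons_cons, List.mem_cons, Prod.mk.injEq] at hxy
        rcases hxy with ⟨rfl, rfl⟩ | ⟨rfl, rfl⟩ | hxy
        · exact Or.inl ha
        · exact Or.inr hm
        · exact hs x y (by simpa using hxy)

/-- Concatenation adds only the joining edges between consecutive paths; these are the only
candidates for bad edges. -/
theorem pathEdges_flatten {K : List (List α)} (hK : [] ∉ K) :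
    (∀ e ∈ coverEdges K, e ∈ pathEdges K.flatten) ∧
      ∀ e ∈ pathEdges K.flatten, e ∈ coverEdges K ∨
        ∃ A B, (A, B) ∈ slots K ∧ ∃ a ∈ A, ∃ b ∈ B, e = s(a, b) := by
  induction K with
  | nil => simp
  | cons A K ih => cases K with
    | nil => simp
    | cons B K =>
      simp only [List.mem_cons, not_or] at hK
      obtain ⟨A', x, rfl⟩ : ∃ A' x, A = A' ++ [x] := by
        obtain ⟨A', x, h⟩ := (List.eq_nil_or_concat A).resolve_left (Ne.symm hK.1)
        exact ⟨A', x, by simpa using h⟩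
      obtain ⟨y, B', rfl⟩ := List.exists_cons_of_ne_nil (Ne.symm hK.2.1)
      obtain ⟨ih1, ih2⟩ := ih (by simpa using hK.2)
      have e1 : ((A' ++ [x]) :: (y :: B') :: K).flatten = A' ++ x :: y :: (B' ++ K.flatten) := by
        simp
      have e2 : ((y :: B') :: K).flatten = y :: (B' ++ K.flatten) := by simp
      rw [e1, pathEdges_append_cons_cons]
      rw [e2] at ih1 ih2
      constructor
      · intro e he
        rw [coverEdges_cons, Multiset.mem_add] at he
        rw [Multiset.mem_cons, Multiset.mem_add]
        rcases he with he | he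
        · exact Or.inr (Or.inl he)
        · exact Or.inr (Or.inr (ih1 e he))
      · intro e he
        rw [Multiset.mem_cons, Multiset.mem_add] at he
        rw [coverEdges_cons, Multiset.mem_add]
        rcases he with rfl | he | he
        · exact Or.inr ⟨A' ++ [x], y :: B', by simp, x, by simp, y, by simp, rfl⟩
        · exact Or.inl (Or.inl he)
        · rcases ih2 e he with he | ⟨C, D, hCD, h⟩
          · exact Or.inl (Or.inr he)
          · exact Or.inr ⟨C, D, by simp [hCD], h⟩

theorem slots_map {β : Type*} (f : α → β) (l : List α) :
    slots (l.map f) = (slots l).map (Prod.map f f) := by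
  induction l with
  | nil => rfl
  | cons a l ih => cases l with
    | nil => rfl
    | cons b l => simpa using ih

theorem pathEdges_map {β : Type*} (f : α → β) (l : List α) :
    pathEdges (l.map f) = (pathEdges l).map (Sym2.map f) := by
  simp [pathEdges, slots_map, Function.comp_def]

theorem coverEdges_map {β : Type*} (f : α → β) (L : List (List α)) :
    coverEdges (L.map (List.map f)) = (coverEdges L).map (Sym2.map f) := by
  induction L with
  | nil => rfl
  | cons l L ih => simp [ih, pathEdges_map]

/-- Elements are coloured greedily: as long as one of `E` is uncoloured, fewer than `E.card` colours
are in use. -/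
theorem exists_injOn_extend {ι : Type*} [Fintype ι] [DecidableEq α] {E₀ E : Finset α}
    (hE : E₀ ⊆ E) {f : α → ι} (hf : Set.InjOn f E₀) (hc : E.card ≤ Fintype.card ι) :
    ∃ g : α → ι, Set.EqOn g f E₀ ∧ Set.InjOn g E := by
  classical
  suffices h : ∀ D : Finset α, D ⊆ E → Disjoint E₀ D →
      ∃ g : α → ι, Set.EqOn g f E₀ ∧ Set.InjOn g (E₀ ∪ D : Finset α) by
    obtain ⟨g, h1, h2⟩ := h (E \ E₀) Finset.sdiff_subset Finset.disjoint_sdiff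
    rw [Finset.union_sdiff_of_subset hE] at h2
    exact ⟨g, h1, h2⟩
  intro D
  induction D using Finset.induction_on with
  | empty => exact fun _ _ => ⟨f, fun _ _ => rfl, by simpa using hf⟩
  | insert d D hd ih =>
    intro hD hdisj
    rw [Finset.disjoint_insert_right] at hdisj
    obtain ⟨g, h1, h2⟩ := ih ((Finset.subset_insert d D).trans hD) hdisj.2
    have hd' : d ∉ E₀ ∪ D := by simp [hd, hdisj.1]
    obtain ⟨i, hi⟩ : ∃ i, i ∉ (E₀ ∪ D).image g := by
      by_contra! hcon
      have h3 : (insert d (E₀ ∪ D)).card ≤ E.card := Finset.card_le_card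
        (Finset.insert_subset (hD (Finset.mem_insert_self d D))
          (Finset.union_subset hE ((Finset.subset_insert d D).trans hD)))
      rw [Finset.card_insert_of_notMem hd'] at h3
      have h4 : Fintype.card ι ≤ (E₀ ∪ D).card := by
        rw [← Finset.card_univ]
        exact (Finset.card_le_card fun i _ => hcon i).trans Finset.card_image_le
      omega
    have hg : ∀ a ∈ E₀ ∪ D, Function.update g d i a = g a := fun a ha =>
      Function.update_of_ne (by rintro rfl; exact hd' ha) _ _
    refine ⟨Function.update g d i, ?_, ?_⟩
    · intro a ha
      rw [hg a (Finset.mem_union_left _ ha)]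
      exact h1 ha
    · rw [Finset.union_insert, Finset.coe_insert, Set.injOn_insert (by simpa using hd')]
      refine ⟨fun a ha b hb hab => ?_, ?_⟩
      · rw [hg a ha, hg b hb] at hab
        exact h2 ha hb hab
      · rintro ⟨a, ha, hai⟩
        rw [hg a ha, Function.update_self] at hai
        exact hi (hai ▸ Finset.mem_image_of_mem g ha)

end Combine

section Forest

variable {V : Type*} {H : SimpleGraph V}

theorem pathEdges_support {a b : V} (p : H.Walk a b) : pathEdges p.support = p.edges := by
  induction p with
  | nil => rfl
  | @cons a b c h p ih =>
    cases p with
    | nil => rfl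
    | cons h' p =>
      rw [SimpleGraph.Walk.support_cons, SimpleGraph.Walk.support_cons, pathEdges_cons_cons,
        ← SimpleGraph.Walk.support_cons h', ih]
      rfl

theorem IsLinearForest.exists_list (hH : IsLinearForest H) (C : H.ConnectedComponent) :
    ∃ l : List V, l.Nodup ∧ l ≠ [] ∧ (∀ x, x ∈ l ↔ H.connectedComponentMk x = C) ∧
      ∀ a b, s(a, b) ∈ pathEdges l ↔ H.Adj a b ∧ H.connectedComponentMk a = C := by
  obtain ⟨a, b, p, hp, hC⟩ := hH.2 C
  have hmem : ∀ x, x ∈ p.support ↔ H.connectedComponentMk x = C := by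
    intro x
    rw [← SimpleGraph.Walk.mem_verts_toSubgraph, hC]
    simp
  refine ⟨p.support, hp.support_nodup, by simp, hmem, fun x y => ?_⟩
  rw [pathEdges_support, Multiset.mem_coe, ← SimpleGraph.Walk.mem_edges_toSubgraph, hC,
    SimpleGraph.Subgraph.mem_edgeSet]
  simp only [SimpleGraph.Subgraph.induce_adj, SimpleGraph.Subgraph.top_adj,
    SimpleGraph.ConnectedComponent.mem_supp_iff]
  constructor
  · tauto
  · rintro ⟨h1, h2⟩
    exact ⟨h2, by rw [← h2]; exact (SimpleGraph.ConnectedComponent.connectedComponentMk_eq_of_adj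
      h1).symm, h1⟩

/-- An inner vertex of the path would have two distinct neighbours in `H`. -/
theorem isEnd_of_degree_le_one {l : List V} {u : V} [Fintype (H.neighborSet u)] (hl : l.Nodup)
    (hu : u ∈ l) (hdeg : H.degree u ≤ 1) (hE : ∀ a b, s(a, b) ∈ pathEdges l → H.Adj a b) :
    IsEnd u l := by
  obtain ⟨P, Q, rfl⟩ := List.append_of_mem hu
  rcases List.eq_nil_or_concat P with rfl | ⟨P', a, rfl⟩
  · exact isEnd_cons u Q
  rw [List.concat_eq_append] at *
  cases Q with
  | nil => exact isEnd_concat u _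
  | cons b Q =>
    exfalso
    have h1 : H.Adj u a := (hE a u (mem_pathEdges.2 ⟨a, u, mem_slots.2 ⟨P', b :: Q, by simp⟩,
      rfl⟩)).symm
    have h2 : H.Adj u b := hE u b (mem_pathEdges.2 ⟨u, b, mem_slots.2 ⟨P' ++ [a], Q, rfl⟩, rfl⟩)
    have hab : a ≠ b := by
      rw [List.nodup_append] at hl
      exact hl.2.2 a (by simp) b (by simp)
    classical
    have : ({a, b} : Finset V) ⊆ H.neighborFinset u := by
      intro z hz
      rw [SimpleGraph.mem_neighborFinset]
      simp only [Finset.mem_insert, Finset.mem_singleton] at hz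
      rcases hz with rfl | rfl <;> assumption
    have := Finset.card_le_card this
    rw [Finset.card_pair hab, SimpleGraph.card_neighborFinset_eq_degree] at this
    omega

theorem mem_support_of_reachable {x y : V} (h : H.Reachable x y) (hne : x ≠ y) : x ∈ H.support := by
  obtain ⟨p⟩ := h
  cases p with
  | nil => exact absurd rfl hne
  | cons h p => exact ⟨_, h⟩

/-- A linear forest with a compatible pair `u, v` as a list of paths, the first one starting in `u`
and the last one ending in `v`. -/
theorem IsLinearForest.exists_lists [Fintype V] [DecidableRel H.Adj] (hH : IsLinearForest H)
    {u v : V} (huv : Compatible H u v) :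
    ∃ (A B : List V) (M : List (List V)),
      (∃ A', A = u :: A') ∧ (∃ B', B = B' ++ [v]) ∧ [] ∉ A :: (M ++ [B]) ∧
      (A :: (M ++ [B])).flatten.Nodup ∧
      (∀ x, x ∈ (A :: (M ++ [B])).flatten ↔ x ∈ forestVerts H u v) ∧
      (∀ e, e ∈ coverEdges (A :: (M ++ [B])) ↔ e ∈ H.edgeSet) ∧
      (M = [] → H.connectedComponentMk '' forestVerts H u v =
        {H.connectedComponentMk u, H.connectedComponentMk v}) := by
  classical
  obtain ⟨hdu, hdv, hne⟩ := huv
  have hex : ∀ C : H.ConnectedComponent, ∃ l : List V, l.Nodup ∧ l ≠ [] ∧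
      (∀ x, x ∈ l ↔ H.connectedComponentMk x = C) ∧
      (∀ a b, s(a, b) ∈ pathEdges l ↔ H.Adj a b ∧ H.connectedComponentMk a = C) ∧
      (C = H.connectedComponentMk u → ∃ A', l = u :: A') ∧
      (C = H.connectedComponentMk v → ∃ B', l = B' ++ [v]) := by
    intro C
    obtain ⟨l, h1, h2, h3, h4⟩ := hH.exists_list C
    have hE : ∀ a b, s(a, b) ∈ pathEdges l → H.Adj a b := fun a b h => ((h4 a b).1 h).1
    have hrev : l.reverse.Nodup ∧ l.reverse ≠ [] ∧
        (∀ x, x ∈ l.reverse ↔ H.connectedComponentMk x = C) ∧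
        ∀ a b, s(a, b) ∈ pathEdges l.reverse ↔ H.Adj a b ∧ H.connectedComponentMk a = C := by
      simpa using And.intro h1 (And.intro h2 (And.intro h3 h4))
    by_cases hu : C = H.connectedComponentMk u
    · have hv : C ≠ H.connectedComponentMk v := fun h => hne (hu.symm.trans h)
      rcases isEnd_of_degree_le_one h1 ((h3 u).2 hu.symm) hdu hE with h | ⟨P, hP⟩
      · exact ⟨l, h1, h2, h3, h4, fun _ => h, fun h => absurd h hv⟩
      · exact ⟨l.reverse, hrev.1, hrev.2.1, hrev.2.2.1, hrev.2.2.2,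
          fun _ => ⟨P.reverse, by simp [hP]⟩, fun h => absurd h hv⟩
    by_cases hv : C = H.connectedComponentMk v
    · rcases isEnd_of_degree_le_one h1 ((h3 v).2 hv.symm) hdv hE with ⟨Q, hQ⟩ | h
      · exact ⟨l.reverse, hrev.1, hrev.2.1, hrev.2.2.1, hrev.2.2.2,
          fun h => absurd h hu, fun _ => ⟨Q.reverse, by simp [hQ]⟩⟩
      · exact ⟨l, h1, h2, h3, h4, fun h => absurd h hu, fun _ => h⟩
    · exact ⟨l, h1, h2, h3, h4, fun h => absurd h hu, fun h => absurd h hv⟩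
  choose g hnd hnil hmem hedge hgu hgv using hex
  -- The other components enter only if they contain an edge; isolated vertices besides `u` and `v`
  -- belong to the complement of the forest.
  let S : Finset H.ConnectedComponent := Finset.univ.filter fun C =>
    C ≠ H.connectedComponentMk u ∧ C ≠ H.connectedComponentMk v ∧
      ∃ x ∈ H.support, H.connectedComponentMk x = C
  let I : List H.ConnectedComponent :=
    H.connectedComponentMk u :: (S.toList ++ [H.connectedComponentMk v])
  have hI : g (H.connectedComponentMk u) :: (S.toList.map g ++ [g (H.connectedComponentMk v)]) =
      I.map g := by simp [I]
  have hInd : I.Nodup := by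
    simp only [I, List.nodup_cons, List.nodup_append, List.mem_append, Finset.mem_toList,
      List.mem_singleton, S, Finset.mem_filter]
    refine ⟨by tauto, Finset.nodup_toList _, by simp, ?_⟩
    rintro C hC D rfl
    exact hC.2.2.1
  have hImem : ∀ C, C ∈ I ↔ ∃ x ∈ forestVerts H u v, H.connectedComponentMk x = C := by
    intro C
    simp only [I, S, forestVerts, List.mem_cons, List.mem_append, Finset.mem_toList,
      Finset.mem_filter, Finset.mem_univ, true_and, List.not_mem_nil, or_false]
    constructor
    · rintro (rfl | ⟨-, -, x, hx, h⟩ | rfl)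
      · exact ⟨u, by simp, rfl⟩
      · exact ⟨x, Or.inl hx, h⟩
      · exact ⟨v, by simp, rfl⟩
    · rintro ⟨x, hx | rfl | rfl, rfl⟩
      · by_cases h1 : H.connectedComponentMk x = H.connectedComponentMk u
        · exact Or.inl h1
        by_cases h2 : H.connectedComponentMk x = H.connectedComponentMk v
        · exact Or.inr (Or.inr h2)
        · exact Or.inr (Or.inl ⟨h1, h2, x, hx, rfl⟩)
      · exact Or.inl rfl
      · exact Or.inr (Or.inr rfl)
  refine ⟨g (H.connectedComponentMk u), g (H.connectedComponentMk v), S.toList.map g,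
    hgu _ rfl, hgv _ rfl, ?_, ?_, ?_, ?_, ?_⟩
  · rw [hI, List.mem_map]
    rintro ⟨C, -, hC⟩
    exact hnil C hC
  · rw [hI, List.nodup_flatten]
    refine ⟨?_, ?_⟩
    · intro l hl
      obtain ⟨C, -, rfl⟩ := List.mem_map.1 hl
      exact hnd C
    · rw [List.pairwise_map]
      refine List.Pairwise.imp ?_ hInd
      intro C D hCD x hx hx'
      exact hCD (((hmem C x).1 hx).symm.trans ((hmem D x).1 hx'))
  · intro x
    rw [hI, List.mem_flatten]
    constructor
    · rintro ⟨l, hl, hx⟩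
      obtain ⟨C, hC, rfl⟩ := List.mem_map.1 hl
      obtain ⟨y, hy, rfl⟩ := (hImem C).1 hC
      have hr := SimpleGraph.ConnectedComponent.exact ((hmem _ x).1 hx)
      by_cases hxy : x = y
      · exact hxy ▸ hy
      · exact Or.inl (mem_support_of_reachable hr hxy)
    · intro hx
      exact ⟨_, List.mem_map_of_mem ((hImem _).2 ⟨x, hx, rfl⟩), (hmem _ x).2 rfl⟩
  · intro e
    rw [hI, mem_coverEdges]
    induction e with
    | h a b =>
      constructor
      · rintro ⟨l, hl, he⟩
        obtain ⟨C, -, rfl⟩ := List.mem_map.1 hl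
        exact ((hedge C a b).1 he).1
      · intro he
        have ha : a ∈ H.support := ⟨b, he⟩
        exact ⟨_, List.mem_map_of_mem ((hImem _).2 ⟨a, Or.inl ha, rfl⟩),
          (hedge _ a b).2 ⟨he, rfl⟩⟩
  · intro hM
    ext C
    have := hImem C
    simp only [Set.mem_image, ← this, I, List.map_eq_nil_iff.1 hM]
    simp

end Forest

end RainbowOre

/-! ### Assembling the theorem. -/

namespace RainbowOre

variable {V : Type*} {n : ℕ} {G : Fin n → SimpleGraph V} {H : SimpleGraph V} {c : Sym2 V → Fin n}
  {u v : V}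

/-- A rainbow path cover of the vertices outside the forest, with few paths, combines with the
paths of the forest to a Hamiltonian path whose bad edges all meet the forest. -/
theorem exists_forestPath_of_cover [Fintype V] [DecidableEq V] (hn : Fintype.card V ≤ n)
    (hc : IsRainbowColoring G H.edgeSet c) {A B : List V} {M : List (List V)}
    (hA : ∃ A', A = u :: A') (hB : ∃ B', B = B' ++ [v]) (hnil : [] ∉ A :: (M ++ [B]))
    (hnd : (A :: (M ++ [B])).flatten.Nodup)
    (hmem : ∀ x, x ∈ (A :: (M ++ [B])).flatten ↔ x ∈ forestVerts H u v)
    (hedge : ∀ e, e ∈ coverEdges (A :: (M ++ [B])) ↔ e ∈ H.edgeSet)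
    {S : List (List {x // x ∉ forestVerts H u v})}
    {col : Sym2 {x // x ∉ forestVerts H u v} → {i // i ∉ c '' H.edgeSet}}
    (hS : IsRainbowCover (fun i : {i // i ∉ c '' H.edgeSet} => (G i).comap Subtype.val) S col)
    (hlen : S.length ≤ M.length + 1) :
    ∃ p col', IsForestPath H c u v p col' ∧
      ∀ e ∈ badEdges G p col', ∃ w ∈ e, w ∈ forestVerts H u v := by
  classical
  let S' : List (List V) := S.map (List.map Subtype.val)
  obtain ⟨K, hK, hslots⟩ := exists_interleave (P := fun l => l ∈ A :: (M ++ [B])) (S := S')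
    (M := M) (by simpa [S'] using hlen) (fun l hl => by simp [hl]) (a := A) (b := B)
    (by simp) (by simp)
  have hperm : (A :: (K ++ [B])).Perm (S' ++ A :: (M ++ [B])) := by
    have h1 : (A :: (K ++ [B])).Perm (A :: (S' ++ M ++ [B])) := (hK.append_right [B]).cons A
    rw [List.append_assoc] at h1
    exact h1.trans List.perm_middle.symm
  have hflat : S'.flatten = S.flatten.map Subtype.val := by
    simp [S', List.map_flatten]
  have hS'nd : S'.flatten.Nodup := by
    rw [hflat]
    exact hS.nodup.map Subtype.val_injective
  have hS'mem : ∀ x, x ∈ S'.flatten ↔ x ∉ forestVerts H u v := by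
    intro x
    rw [hflat, List.mem_map]
    constructor
    · rintro ⟨y, -, rfl⟩
      exact y.2
    · intro hx
      exact ⟨⟨x, hx⟩, hS.cover _, rfl⟩
  have hKnil : [] ∉ A :: (K ++ [B]) := by
    rw [hperm.mem_iff, List.mem_append, not_or]
    refine ⟨?_, hnil⟩
    intro h
    obtain ⟨l, hl, h⟩ := List.mem_map.1 h
    rw [List.map_eq_nil_iff] at h
    exact hS.ne_nil (h ▸ hl)
  have hpnd : (A :: (K ++ [B])).flatten.Nodup := by
    rw [hperm.flatten.nodup_iff, List.flatten_append, List.nodup_append]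
    refine ⟨hS'nd, hnd, ?_⟩
    rintro x hx y hy rfl
    exact (hS'mem x).1 hx ((hmem x).1 hy)
  have hcover : ∀ x, x ∈ (A :: (K ++ [B])).flatten := by
    intro x
    rw [hperm.flatten.mem_iff, List.flatten_append, List.mem_append, hS'mem, hmem]
    exact (Classical.em _).symm
  have hE : ∀ e, e ∈ coverEdges (A :: (K ++ [B])) ↔
      (∃ f ∈ coverEdges S, Sym2.map Subtype.val f = e) ∨ e ∈ H.edgeSet := by
    intro e
    rw [coverEdges_perm hperm, coverEdges_append, Multiset.mem_add, hedge, coverEdges_map,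
      Multiset.mem_map]
  have hsupp : ∀ f : Sym2 {x // x ∉ forestVerts H u v}, Sym2.map Subtype.val f ∉ H.edgeSet := by
    intro f hf
    induction f with
    | h a b => exact a.2 (Or.inl ⟨b.1, hf⟩)
  have hval : Function.Injective (Sym2.map (Subtype.val : {x // x ∉ forestVerts H u v} → V)) :=
    Sym2.map.injective Subtype.val_injective
  -- The colouring of the cover, with `c` as the value elsewhere. The cover avoids the colours of
  -- `H`, so the union is still injective.
  let col₀ : Sym2 V → Fin n := Function.extend (Sym2.map Subtype.val) (fun f => (col f).1) c
  have hcS : ∀ f, col₀ (Sym2.map Subtype.val f) = (col f).1 := fun f => hval.extend_apply _ _ f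
  have hcH : ∀ e ∈ H.edgeSet, col₀ e = c e := fun e he =>
    Function.extend_apply' _ _ _ (by rintro ⟨f, rfl⟩; exact hsupp f he)
  have hinj : Set.InjOn col₀ ((coverEdges (A :: (K ++ [B]))).toFinset : Set (Sym2 V)) := by
    intro e he f hf hef
    rw [Finset.mem_coe, Multiset.mem_toFinset, hE] at he hf
    rcases he with ⟨e, he, rfl⟩ | he <;> rcases hf with ⟨f, hf, rfl⟩ | hf
    · rw [hcS, hcS] at hef
      rw [hS.inj he hf (Subtype.ext hef)]
    · rw [hcS, hcH f hf] at hef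
      exact absurd ⟨f, hf, hef.symm⟩ (col e).2
    · rw [hcS, hcH e he] at hef
      exact absurd ⟨e, he, hef⟩ (col f).2
    · rw [hcH e he, hcH f hf] at hef
      exact hc.1 he hf hef
  obtain ⟨hsub, hcon⟩ := pathEdges_flatten hKnil
  have hpne : (A :: (K ++ [B])).flatten ≠ [] := by
    obtain ⟨A', rfl⟩ := hA
    simp
  have hcard : (pathEdges (A :: (K ++ [B])).flatten).toFinset.card ≤ Fintype.card (Fin n) := by
    have h1 := Multiset.toFinset_card_le (pathEdges (A :: (K ++ [B])).flatten)
    have h2 := card_pathEdges hpne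
    have h3 := hpnd.length_le_card
    rw [Fintype.card_fin]
    omega
  -- The joining edges receive arbitrary new colours; the at most n - 1 edges of the path leave room
  -- for this.
  obtain ⟨col', hcol', hinj'⟩ := exists_injOn_extend
    (E := (pathEdges (A :: (K ++ [B])).flatten).toFinset)
    (fun e he => by simpa using hsub e (by simpa using he)) hinj hcard
  have hcol₀ : ∀ e ∈ coverEdges (A :: (K ++ [B])), col' e = col₀ e := fun e he =>
    hcol' (by simpa using he)
  refine ⟨(A :: (K ++ [B])).flatten, col', ⟨hpnd, hcover, ?_, ?_, ?_, ?_, ?_⟩, ?_⟩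
  · obtain ⟨A', rfl⟩ := hA
    simp
  · obtain ⟨B', rfl⟩ := hB
    have : (A :: (K ++ [B' ++ [v]])).flatten = (A ++ K.flatten ++ B') ++ [v] := by simp
    rw [this, List.getLast?_concat]
  · exact fun e he => hsub e ((hE e).2 (Or.inr he))
  · intro e he f hf hef
    exact hinj' (by simpa using he) (by simpa using hf) hef
  · intro e he
    rw [hcol₀ e ((hE e).2 (Or.inr he)), hcH e he]
  · intro e he
    simp only [badEdges, Multiset.mem_filter] at he
    rcases hcon e he.1 with h | ⟨C, D, hCD, a, ha, b, hb, rfl⟩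
    · exfalso
      apply he.2
      rw [hcol₀ e h]
      rcases (hE e).1 h with ⟨f, hf, rfl⟩ | h
      · rw [hcS]
        have := hS.mem f hf
        induction f with
        | h a b => exact this
      · rw [hcH e h]
        exact hc.2 e h
    · rcases hslots C D hCD with h | h
      · exact ⟨a, by simp, (hmem a).1 (List.mem_flatten.2 ⟨C, h, ha⟩)⟩
      · exact ⟨b, by simp, (hmem b).1 (List.mem_flatten.2 ⟨D, h, hb⟩)⟩

/-- A rainbow Hamiltonian path given as a list is one given as a walk. -/
theorem IsForestPath.exists_walk [DecidableEq V] {p : List V} {col : Sym2 V → Fin n}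
    (h : IsForestPath H c u v p col) (hG : ∀ e ∈ pathEdges p, e ∈ (G (col e)).edgeSet) :
    ∃ (w : (⊤ : SimpleGraph V).Walk u v) (c' : Sym2 V → Fin n),
      w.IsHamiltonian ∧ H.edgeSet ⊆ w.edgeSet ∧
      IsRainbowColoring G w.edgeSet c' ∧ Set.EqOn c' c H.edgeSet := by
  have hchain : p.IsChain (⊤ : SimpleGraph V).Adj := by
    refine List.Pairwise.isChain (h.nodup.imp ?_)
    intro a b hab
    simpa using hab
  have hu : p.head h.ne_nil = u := by
    have := h.head
    rw [List.head?_eq_some_head h.ne_nil] at this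
    simpa using this
  have hv : p.getLast h.ne_nil = v := by
    have := h.last
    rw [List.getLast?_eq_some_getLast h.ne_nil] at this
    simpa using this
  obtain ⟨w, hw⟩ : ∃ w : (⊤ : SimpleGraph V).Walk u v, w.support = p := by
    exact ⟨(SimpleGraph.Walk.ofSupport p h.ne_nil hchain).copy hu hv, by simp⟩
  have hwE : ∀ e, e ∈ w.edgeSet ↔ e ∈ pathEdges p := by
    intro e
    rw [← hw, pathEdges_support]
    rfl
  refine ⟨w, col, ?_, fun e he => (hwE e).2 (h.sub e he), ⟨?_, fun e he => hG e ((hwE e).1 he)⟩,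
    h.eqOn⟩
  · intro a
    rw [hw]
    exact List.count_eq_one_of_mem h.nodup (h.cover a)
  · intro e he f hf hef
    exact h.inj ((hwE e).1 he) ((hwE f).1 hf) hef

theorem le_degree_add_degree_of_le_sigma2 [Fintype V] {F : SimpleGraph V} [DecidableRel F.Adj]
    {r : ℕ} (h : (r : ℕ∞) ≤ sigma2 F) {x y : V} (hxy : x ≠ y) (hadj : ¬ F.Adj x y) :
    r ≤ F.degree x + F.degree y := by
  have h1 : sigma2 F ≤ ((F.degree x + F.degree y : ℕ) : ℕ∞) :=
    iInf_le_of_le x (iInf_le_of_le y (iInf_le_of_le ⟨hxy, hadj⟩ le_rfl))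
  exact_mod_cast h.trans h1

theorem degree_eq_degree_comap_add [Fintype V] (F : SimpleGraph V) [DecidableRel F.Adj]
    (W : Finset V) (P : V → Prop) [DecidablePred P] (hW : ∀ x, x ∈ W ↔ ¬ P x)
    [DecidableRel (F.comap (Subtype.val : {x // P x} → V)).Adj] (x : {x // P x}) :
    F.degree x = (F.comap Subtype.val).degree x + (W.filter (F.Adj x)).card := by
  classical
  have h : F.neighborFinset x = ((F.comap Subtype.val).neighborFinset x).map
      (Function.Embedding.subtype P) ∪ W.filter (F.Adj x) := by
    ext z
    simp only [SimpleGraph.mem_neighborFinset, Finset.mem_union, Finset.mem_map,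
      Finset.mem_filter, hW, SimpleGraph.comap_adj, Function.Embedding.subtype_apply]
    constructor
    · intro hz
      by_cases hP : P z
      · exact Or.inl ⟨⟨z, hP⟩, hz, rfl⟩
      · exact Or.inr ⟨hP, hz⟩
    · rintro (⟨y, hy, rfl⟩ | ⟨-, hz⟩)
      · exact hy
      · exact hz
  rw [← SimpleGraph.card_neighborFinset_eq_degree, h, Finset.card_union_of_disjoint,
    Finset.card_map, SimpleGraph.card_neighborFinset_eq_degree]
  rw [Finset.disjoint_left]
  intro z hz hz'
  obtain ⟨y, -, rfl⟩ := Finset.mem_map.1 hz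
  exact (hW _).1 (Finset.mem_filter.1 hz').1 y.2

end RainbowOre

theorem theorem1p6 {V : Type*} [Fintype V] [DecidableEq V] (n k : ℕ)
    (hV : Fintype.card V = n) (hk : (k : ℚ) ≤ ((n : ℚ) - 4) / 3)
    (G : Fin n → SimpleGraph V) [∀ i, DecidableRel (G i).Adj]
    (hG : ∀ i, ((n + k : ℕ) : ℕ∞) ≤ RainbowOre.sigma2 (G i))
    (H : SimpleGraph V) [DecidableRel H.Adj]
    (hH : RainbowOre.IsLinearForest H) (hHk : H.edgeFinset.card = k)
    (c : Sym2 V → Fin n) (hc : RainbowOre.IsRainbowColoring G H.edgeSet c)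
    (u v : V) (huv : RainbowOre.Compatible H u v) :
    -- (C1)
    (∃ (p : (⊤ : SimpleGraph V).Walk u v) (c' : Sym2 V → Fin n),
      p.IsHamiltonian ∧ H.edgeSet ⊆ p.edgeSet ∧
      RainbowOre.IsRainbowColoring G p.edgeSet c' ∧ Set.EqOn c' c H.edgeSet) ∨
    -- (C2)
    (H.connectedComponentMk '' RainbowOre.forestVerts H u v =
        {H.connectedComponentMk u, H.connectedComponentMk v} ∧
      ∃ X Y : Finset V, Disjoint X Y ∧
        (X : Set V) ∪ (Y : Set V) = (RainbowOre.forestVerts H u v)ᶜ ∧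
        1 ≤ X.card ∧ 1 ≤ Y.card ∧
        ∀ i ∉ c '' H.edgeSet,
          (G i).IsClique X ∧ (G i).IsClique Y ∧
          (∀ x ∈ X, ∀ y ∈ Y, ¬ (G i).Adj x y) ∧
          ∀ w ∈ RainbowOre.forestVerts H u v, ∀ z ∈ X ∪ Y, (G i).Adj w z) ∨
    -- (C3)
    (∃ X Y : Finset V, Disjoint X Y ∧ X ∪ Y = Finset.univ ∧
      (X.card : ℚ) = ((n : ℚ) + k) / 2 ∧ (Y.card : ℚ) = ((n : ℚ) - k) / 2 ∧
      RainbowOre.forestVerts H u v ⊆ X ∧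
      ∀ i ∉ c '' H.edgeSet,
        (∀ x ∈ X, ∀ y ∈ Y, (G i).Adj x y) ∧ (G i).IsIndepSet Y) := by
  classical
  obtain ⟨A, B, M, hA, hB, hnil, hnd, hmem, hedge, hM⟩ := hH.exists_lists huv
  have hore : ∀ i x y, x ≠ y → ¬ (G i).Adj x y → n + k ≤ (G i).degree x + (G i).degree y :=
    fun i x y hxy hadj => RainbowOre.le_degree_add_degree_of_le_sigma2 (hG i) hxy hadj
  let W : Finset V := (A :: (M ++ [B])).flatten.toFinset
  have hWmem : ∀ x, x ∈ W ↔ x ∈ RainbowOre.forestVerts H u v := fun x => by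
    rw [List.mem_toFinset, hmem]
  have hWmem' : ∀ x, x ∈ W ↔ ¬ x ∉ RainbowOre.forestVerts H u v := fun x => by
    rw [hWmem, not_not]
  -- A linear forest has as many vertices as edges and components together; the 2 counts the
  -- components of `u` and `v`.
  have hWcard : W.card = k + (M.length + 2) := by
    have h1 := RainbowOre.card_coverEdges hnil
    have h2 : (RainbowOre.coverEdges (A :: (M ++ [B]))).card = k := by
      rw [← hHk, ← Multiset.toFinset_card_of_nodup (RainbowOre.nodup_coverEdges hnd)]
      congr 1
      ext e
      simp [-RainbowOre.coverEdges_cons, hedge]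
    rw [List.toFinset_card_of_nodup hnd, ← h1, h2]
    simp
  have hUcard : Fintype.card {x // x ∉ RainbowOre.forestVerts H u v} + W.card = n := by
    have h1 : Fintype.card {x // x ∉ RainbowOre.forestVerts H u v} = Wᶜ.card := by
      rw [Fintype.card_subtype]
      congr 1
      ext x
      simp [hWmem]
    rw [h1, Finset.card_compl, hV, Nat.sub_add_cancel]
    rw [← hV]
    exact Finset.card_le_univ W
  have hιcard : Fintype.card {i // i ∉ c '' H.edgeSet} + k = n := by
    have h1 : (H.edgeFinset.image c).card = k := by
      rw [Finset.card_image_of_injOn (by simpa using hc.1), hHk]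
    have h2 : Fintype.card {i // i ∉ c '' H.edgeSet} = (H.edgeFinset.image c)ᶜ.card := by
      rw [Fintype.card_subtype]
      congr 1
      ext x
      simp
    have h3 := Finset.card_le_univ (H.edgeFinset.image c)
    rw [Fintype.card_fin] at h3
    rw [h2, Finset.card_compl, h1, Fintype.card_fin]
    omega
  have hdeg := fun (i : Fin n) (x : {x // x ∉ RainbowOre.forestVerts H u v}) =>
    RainbowOre.degree_eq_degree_comap_add (G i) W _ hWmem' x
  have hWle : ∀ (i : Fin n) (x : V), (W.filter ((G i).Adj x)).card ≤ W.card :=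
    fun i x => Finset.card_filter_le _ _
  -- Non-adjacent vertices outside the forest with small degree sum are joined to the whole forest.
  have hfull : ∀ (i : Fin n) (x y : {x // x ∉ RainbowOre.forestVerts H u v}), x ≠ y →
      ¬ (G i).Adj x y → ((G i).comap Subtype.val).degree x + ((G i).comap Subtype.val).degree y +
        (M.length + 2) ≤ Fintype.card {x // x ∉ RainbowOre.forestVerts H u v} →
      ∀ w ∈ RainbowOre.forestVerts H u v, (G i).Adj w x := by
    intro i x y hxy hadj hle w hw
    have h1 := hore i x y (fun h => hxy (Subtype.ext h)) hadj
    rw [hdeg, hdeg] at h1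
    have h2 := hWle i x
    have h3 := hWle i y
    -- With m = `M.length + 2`, the Ore bound leaves n + k - (|U| - m) = 2|W| for the neighbours in
    -- `W`, so both vertices see all of `W`.
    have h4 : (W.filter ((G i).Adj x)).card = W.card := by omega
    exact (Finset.filter_card_eq h4 w ((hWmem w).2 hw)).symm
  have hk' : 3 * k + 4 ≤ n := by
    have : (3 * k + 4 : ℚ) ≤ n := by linarith
    exact_mod_cast this
  -- Restriction to the complement of the forest costs a pair at most 2|W| = 2(k + m), which leaves
  -- |U| - m; the unused colours number exactly |U| + m.
  rcases RainbowOre.exists_rainbowCover_or_extremal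
    (fun i : {i // i ∉ c '' H.edgeSet} => (G i).comap
      (Subtype.val : {x // x ∉ RainbowOre.forestVerts H u v} → V)) (M.length + 2) (by omega)
    (by omega) (by
      intro i x y hxy hadj
      have h1 := hore i x y (fun h => hxy (Subtype.ext h)) hadj
      rw [hdeg, hdeg] at h1
      have h2 := hWle i x
      have h3 := hWle i y
      omega) with ⟨S, col, hS, hlen⟩ | ⟨hm, X, Y, hXY, hU, hX, hY, hadj⟩ | ⟨T, hT, hadj⟩
  · left
    obtain ⟨p, col', hp, hbad⟩ := RainbowOre.exists_forestPath_of_cover hV.le hc hA hB hnil hnd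
      hmem hedge hS (by omega)
    obtain ⟨p', col'', hp', hgood⟩ := hp.exists_rainbow (G := G) (by simp [hV]) hc.2
      (by rw [hV, hHk]; exact hore) hbad
    exact hp'.exists_walk hgood
  · right; left
    have hM0 : M = [] := List.length_eq_zero_iff.1 (by omega)
    refine ⟨hM hM0, X.map (.subtype _), Y.map (.subtype _), ?_, ?_, ?_, ?_, ?_⟩
    · rwa [Finset.disjoint_map]
    · rw [← Finset.coe_union, ← Finset.map_union, hU]
      ext x
      simp
    · rw [Finset.card_map]; exact hX.card_pos
    · rw [Finset.card_map]; exact hY.card_pos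
    · intro i hi
      obtain ⟨hXi, hYi⟩ := hadj ⟨i, hi⟩
      have hno : ∀ x ∈ X, ∀ y ∈ Y, ¬ (G i).Adj x y := fun x hx y hy h =>
        Finset.disjoint_left.1 hXY ((hXi x hx y).1 h).1 hy
      have hdegX : ∀ x ∈ X, ((G i).comap
          (Subtype.val : {x // x ∉ RainbowOre.forestVerts H u v} → V)).degree x + 1 = X.card := by
        intro x hx
        rw [← Finset.card_erase_add_one hx, ← SimpleGraph.card_neighborFinset_eq_degree]
        congr 2
        ext z
        rw [SimpleGraph.mem_neighborFinset, Finset.mem_erase]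
        exact (hXi x hx z).trans and_comm
      have hdegY : ∀ x ∈ Y, ((G i).comap
          (Subtype.val : {x // x ∉ RainbowOre.forestVerts H u v} → V)).degree x + 1 = Y.card := by
        intro x hx
        rw [← Finset.card_erase_add_one hx, ← SimpleGraph.card_neighborFinset_eq_degree]
        congr 2
        ext z
        rw [SimpleGraph.mem_neighborFinset, Finset.mem_erase]
        exact (hYi x hx z).trans and_comm
      have hsum : X.card + Y.card = Fintype.card {x // x ∉ RainbowOre.forestVerts H u v} := by
        rw [← Finset.card_union_of_disjoint hXY, hU, Finset.card_univ]
      have hne : ∀ x ∈ X, ∀ y ∈ Y, x ≠ y := fun x hx y hy h =>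
        Finset.disjoint_left.1 hXY hx (h ▸ hy)
      refine ⟨?_, ?_, ?_, ?_⟩
      · intro a ha b hb hab
        obtain ⟨a, ha', rfl⟩ := Finset.mem_map.1 ha
        obtain ⟨b, hb', rfl⟩ := Finset.mem_map.1 hb
        exact (hXi a ha' b).2 ⟨hb', fun h => hab (by rw [h])⟩
      · intro a ha b hb hab
        obtain ⟨a, ha', rfl⟩ := Finset.mem_map.1 ha
        obtain ⟨b, hb', rfl⟩ := Finset.mem_map.1 hb
        exact (hYi a ha' b).2 ⟨hb', fun h => hab (by rw [h])⟩
      · intro a ha b hb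
        obtain ⟨a, ha', rfl⟩ := Finset.mem_map.1 ha
        obtain ⟨b, hb', rfl⟩ := Finset.mem_map.1 hb
        exact hno a ha' b hb'
      · intro w hw z hz
        obtain ⟨x₀, hx₀⟩ := hX
        obtain ⟨y₀, hy₀⟩ := hY
        rw [← Finset.map_union, Finset.mem_map] at hz
        obtain ⟨z, hz, rfl⟩ := hz
        rcases Finset.mem_union.1 hz with hz | hz
        -- The degrees |X| - 1 and |Y| - 1 sum to |U| - 2, the tight value for two components.
        · have h1 := hdegX z hz
          have h2 := hdegY y₀ hy₀
          exact hfull i z y₀ (hne z hz y₀ hy₀) (hno z hz y₀ hy₀) (by omega) w hw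
        · have h1 := hdegX x₀ hx₀
          have h2 := hdegY z hz
          exact hfull i z x₀ (hne x₀ hx₀ z hz).symm (fun h => hno x₀ hx₀ z hz h.symm)
            (by omega) w hw
  · right; right
    have hYc : (Tᶜ.map (Function.Embedding.subtype
        (· ∉ RainbowOre.forestVerts H u v))).card + T.card =
        Fintype.card {x // x ∉ RainbowOre.forestVerts H u v} := by
      rw [Finset.card_map, Finset.card_compl, Nat.sub_add_cancel (Finset.card_le_univ T)]
    set Y : Finset V := Tᶜ.map (Function.Embedding.subtype
      (· ∉ RainbowOre.forestVerts H u v)) with hY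
    have hXc : Yᶜ.card + Y.card = n := by
      rw [Finset.card_compl, hV, Nat.sub_add_cancel]
      rw [← hV]
      exact Finset.card_le_univ Y
    -- From 2|T| + m = |U| one gets 2|Y| = 2(|U| - |T|) = |U| + m = n - k.
    have hY2 : 2 * Y.card + k = n := by omega
    have hX2 : 2 * Yᶜ.card = n + k := by omega
    refine ⟨Yᶜ, Y, disjoint_compl_left, ?_, ?_, ?_, ?_, ?_⟩
    · ext x
      rw [Finset.mem_union, Finset.mem_compl]
      exact iff_of_true (Classical.em _).symm (Finset.mem_univ x)
    · have : (2 * Yᶜ.card : ℚ) = n + k := by exact_mod_cast hX2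
      linarith
    · have : (2 * Y.card + k : ℚ) = n := by exact_mod_cast hY2
      linarith
    · intro x hx
      rw [Finset.mem_coe, Finset.mem_compl, hY, Finset.mem_map]
      rintro ⟨y, -, rfl⟩
      exact y.2 hx
    · intro i hi
      have hTi := hadj ⟨i, hi⟩
      have hdegT : ∀ y ∉ T, ((G i).comap
          (Subtype.val : {x // x ∉ RainbowOre.forestVerts H u v} → V)).degree y = T.card := by
        intro y hy
        rw [← SimpleGraph.card_neighborFinset_eq_degree]
        congr 1
        ext z
        rw [SimpleGraph.mem_neighborFinset]
        exact hTi y hy z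
      refine ⟨?_, ?_⟩
      · intro x hx y hy
        rw [hY, Finset.mem_map] at hy
        obtain ⟨y, hy, rfl⟩ := hy
        rw [Finset.mem_compl] at hy
        by_cases hxW : x ∈ RainbowOre.forestVerts H u v
        -- A partner for `y` in the independent set, which has (n - k)/2 ≥ k + 2 vertices. Both have
        -- degree |T| inside `U`, and 2|T| = |U| - m is tight.
        · obtain ⟨y', hy', hne⟩ : ∃ y' ∈ Tᶜ, y' ≠ y :=
            Finset.exists_mem_ne (by rw [hY, Finset.card_map] at hY2; omega) y
          rw [Finset.mem_compl] at hy'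
          have h1 := hdegT y hy
          have h2 := hdegT y' hy'
          exact hfull i y y' hne.symm (fun h => hy' ((hTi y hy y').1 h)) (by omega) x hxW
        · have hxT : (⟨x, hxW⟩ : {x // x ∉ RainbowOre.forestVerts H u v}) ∈ T := by
            by_contra hxT
            rw [Finset.mem_compl, hY, Finset.mem_map] at hx
            exact hx ⟨⟨x, hxW⟩, by simpa using hxT, rfl⟩
          exact ((hTi y hy ⟨x, hxW⟩).2 hxT).symm
      · intro a ha b hb _
        rw [hY, Finset.coe_map] at ha hb
        obtain ⟨a, ha, rfl⟩ := ha
        obtain ⟨b, hb, rfl⟩ := hb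
        have ha' : a ∉ T := by simpa using ha
        have hb' : b ∉ T := by simpa using hb
        exact fun h => hb' ((hTi a ha' b).1 h)
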